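/- Let $M$, $M/K$, $M/H$ be smooth, Hausdorff, finite-dimensional manifolds, let $H$ be a finite-dimensional Lie group acting smoothly on $M$ from the right, and let $K\le H$ be a closed subgroup. Let $\pi_H\colon M\to M/H$ be a principal $H$-bundle and $\pi_K\colon M\to M/K$ a principal $K$-bundle for the restricted action (surjective submersions on whose fibres $H$, respectively $K$, acts freely and transitively), and let $\pi\colon M/K\to M/H$ be the map with $\pi\circ\pi_K=\pi_H$. Let $g$ be an $H$-invariant Riemannian metric on $M$ such that the bilinear form $\mathbb I_m(\xi,\eta)=g(\sigma_m(\xi),\sigma_m(\eta))$ on the Lie algebra $\mathfrak h$ of $H$, where $\sigma_m(\xi)=\frac{d}{dt}\big|_{t=0}m.\exp(t\xi)$, does not depend on $m\in M$. Put $\mathscr D_H=(\ker d\pi_H)^{\perp}$, $\mathscr D_K=(\ker d\pi_K)^{\perp}$, and $\mathscr D=d\pi_K(\mathscr D_H)\subset T(M/K)$. Let $g_{\mathscr D_H}=g|_{\mathscr D_H}$, let $g_{M/K}$ be the Riemannian metric on $M/K$ given by $g_{M/K}(d\pi_K v,d\pi_K w)=g(v,w)$ for $v,w\in\mathscr D_K$,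 and let $g_{\mathscr D}=g_{M/K}|_{\mathscr D}$. For a sub-Riemannian manifold $(N,D,g_D)$ let $\sharp\lambda\in D_x$, for $\lambda\in T_x^*N$, be the vector with $\lambda(w)=g_D(\sharp\lambda,w)$ for all $w\in D_x$, let $\mathbf H^D(x,\lambda)=\frac12 g_D(\sharp\lambda,\sharp\lambda)$, and let $\overrightarrow{\mathbf H}^D$ be the Hamiltonian vector field of $\mathbf H^D$ for the canonical symplectic form of $T^*N$. Let $\gamma_D(t;x,\lambda)$ be the projection to $N$ of the integral curve of $\overrightarrow{\mathbf H}^D$ that starts at $(x,\lambda)$ at time $0$. Let $m\in M$, $n=\pi_K(m)$, $\mu\in T_n^*(M/K)$, and $\lambda=\mu\circ d_m\pi_K\in T_m^*M$. Then the geodesics $\gamma_{\mathscr D_H}(t;m,\lambda)$ in $(M,\mathscr D_H,g_{\mathscr D_H})$ and $\gamma_{\mathscr D}(t;n,\mu)$ in $(M/K,\mathscr D,g_{\mathscr D})$ exist for all sufficiently small $|t|$, and $$\pi_H\big(\gamma_{\mathscr D_H}(t;m,\lambda)\big)=\pi\big(\gamma_{\mathscr D}(t;n,\mu)\big)$$ for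 all $t$ in every open interval around $0$ on which both are defined. -/

import Mathlib

open scoped Manifold ContDiff RightActions
open Set

noncomputable section

namespace NestedBundle

/-! ### The cotangent bundle, its symplectic form, and Hamiltonian vector fields -/

section Cotangent

variable (E : Type*) [NormedAddCommGroup E] [NormedSpace ℝ E]
  (M : Type*) [TopologicalSpace M] [ChartedSpace E M] [IsManifold 𝓘(ℝ, E) ∞ M]

/-- The cotangent bundle `T*M` of a manifold modelled on `E`, with the topology and the manifold
structure that Mathlib puts on the bundle of continuous linear maps `TM → ℝ`. Its points are pairs
`⟨x, p⟩` with `p` a linear form on the tangent space at `x`. -/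
abbrev CotangentBundle : Type _ :=
  Bundle.TotalSpace (E →L[ℝ] ℝ) (fun x : M => TangentSpace 𝓘(ℝ, E) x →L[ℝ] ℝ)

/-- The model with corners of the cotangent bundle: `T*M` is modelled on `E × E*`. -/
abbrev cotangentModel :
    ModelWithCorners ℝ (E × (E →L[ℝ] ℝ)) (ModelProd E (E →L[ℝ] ℝ)) :=
  𝓘(ℝ, E).prod 𝓘(ℝ, E →L[ℝ] ℝ)

variable {E M}

/-- The footpoint projection `T*M → M`. -/
def cotangentProj (z : CotangentBundle E M) : M := z.proj

/-- The tautological (Liouville) one-form on `T*M`: at `z = ⟨x, p⟩` it sends `X` to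
`p (dΠ X)`, where `Π : T*M → M` is the footpoint projection. -/
def liouvilleForm (z : CotangentBundle E M) : TangentSpace (cotangentModel E) z →L[ℝ] ℝ :=
  z.snd.comp (mfderiv (cotangentModel E) 𝓘(ℝ, E) (cotangentProj (E := E) (M := M)) z)

/-- The tautological one-form read in the chart of `T*M` at `z₀`: the pull-back of
`liouvilleForm` under the inverse of the chart. -/
def liouvilleInChart (z₀ : CotangentBundle E M) (y : E × (E →L[ℝ] ℝ)) :
    (E × (E →L[ℝ] ℝ)) →L[ℝ] ℝ :=
  (liouvilleForm ((extChartAt (cotangentModel E) z₀).symm y)).comp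
    (mfderiv 𝓘(ℝ, E × (E →L[ℝ] ℝ)) (cotangentModel E) (extChartAt (cotangentModel E) z₀).symm y)

/-- The canonical symplectic form `ω = -dθ` on `T*M`, where `θ` is the tautological one-form. The
exterior derivative at `z` is computed in the chart at `z`, by
`dθ(u, v) = (D_u θ)(v) - (D_v θ)(u)`. In canonical coordinates `ω = ∑ dqⁱ ∧ dpᵢ`. -/
def symplecticForm (z : CotangentBundle E M) (X Y : TangentSpace (cotangentModel E) z) : ℝ :=
  let u : E × (E →L[ℝ] ℝ) :=
    mfderiv (cotangentModel E) 𝓘(ℝ, E × (E →L[ℝ] ℝ)) (extChartAt (cotangentModel E) z) z X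
  let v : E × (E →L[ℝ] ℝ) :=
    mfderiv (cotangentModel E) 𝓘(ℝ, E × (E →L[ℝ] ℝ)) (extChartAt (cotangentModel E) z) z Y
  fderiv ℝ (liouvilleInChart z) (extChartAt (cotangentModel E) z z) v u
    - fderiv ℝ (liouvilleInChart z) (extChartAt (cotangentModel E) z z) u v

/-- In canonical coordinates `(q, p)` the tautological one-form is `∑ pᵢ dqⁱ`. -/
theorem liouvilleInChart_apply (z₀ : CotangentBundle E M) {y : E × (E →L[ℝ] ℝ)}
    (hy : y ∈ (extChartAt (cotangentModel E) z₀).target) (u : E × (E →L[ℝ] ℝ)) :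
    liouvilleInChart z₀ y u = y.2 u.1 := by
  set z := (extChartAt (cotangentModel E) z₀).symm y with hz
  have hzs : z ∈ (extChartAt (cotangentModel E) z₀).source :=
    (extChartAt (cotangentModel E) z₀).map_target hy
  have hyz : extChartAt (cotangentModel E) z₀ z = y :=
    (extChartAt (cotangentModel E) z₀).right_inv hy
  have hx : z.proj ∈ (chartAt E z₀.proj).source := by
    rw [FiberBundle.extChartAt] at hzs
    simp only [mfld_simps] at hzs
    exact hzs.1.1
  have hy1 : extChartAt 𝓘(ℝ, E) z₀.proj z.proj = y.1 := by
    have hb : z.proj ∈ (trivializationAt (E →L[ℝ] ℝ)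
        (fun x : M => TangentSpace 𝓘(ℝ, E) x →L[ℝ] ℝ) z₀.proj).baseSet := by
      rw [hom_trivializationAt_baseSet]
      simpa using hx
    rw [← hyz, FiberBundle.extChartAt]
    simp [Bundle.Trivialization.coe_fst' _ hb]
  have hy2 : y.2 = z.snd.comp ((trivializationAt E (TangentSpace 𝓘(ℝ, E)) z₀.proj).symmL ℝ z.proj) := by
    rw [← hyz, FiberBundle.extChartAt]
    ext v
    simp [hom_trivializationAt_apply, ContinuousLinearMap.inCoordinates]
  have hd : mfderiv 𝓘(ℝ, E × (E →L[ℝ] ℝ)) 𝓘(ℝ, E)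
      (cotangentProj ∘ (extChartAt (cotangentModel E) z₀).symm) y =
      (mfderiv (cotangentModel E) 𝓘(ℝ, E) (cotangentProj (E := E) (M := M)) z).comp
        (mfderiv 𝓘(ℝ, E × (E →L[ℝ] ℝ)) (cotangentModel E)
          (extChartAt (cotangentModel E) z₀).symm y) := by
    refine mfderiv_comp y ?_ ?_
    · exact (Bundle.contMDiff_proj _ (n := ∞)).mdifferentiable (by simp) _
    · have := mdifferentiableWithinAt_extChartAt_symm hy
      exact this.mdifferentiableAt (Filter.mem_of_superset
        ((isOpen_extChartAt_target z₀).mem_nhds hy) (extChartAt_target_subset_range z₀))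
  have hd' : mfderiv 𝓘(ℝ, E × (E →L[ℝ] ℝ)) 𝓘(ℝ, E)
      (cotangentProj ∘ (extChartAt (cotangentModel E) z₀).symm) y =
      (mfderiv 𝓘(ℝ, E) 𝓘(ℝ, E) (extChartAt 𝓘(ℝ, E) z₀.proj).symm y.1).comp
        (ContinuousLinearMap.fst ℝ E (E →L[ℝ] ℝ)) := by
    have he : (cotangentProj ∘ (extChartAt (cotangentModel E) z₀).symm) =ᶠ[nhds y]
        (extChartAt 𝓘(ℝ, E) z₀.proj).symm ∘ Prod.fst := by
      filter_upwards [(isOpen_extChartAt_target (I := cotangentModel E) z₀).mem_nhds hy] with w hw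
      have hw' : w ∈ (chartAt (ModelProd E (E →L[ℝ] ℝ)) z₀).target := by
        rw [extChartAt_target] at hw
        exact hw.1
      exact FiberBundle.chartedSpace_chartAt_symm_fst _ _ hw'
    have hy1' : y.1 ∈ (extChartAt 𝓘(ℝ, E) z₀.proj).target := by
      rw [FiberBundle.extChartAt_target] at hy
      exact hy.1.1
    rw [he.mfderiv_eq, mfderiv_comp (I' := 𝓘(ℝ, E)) y
      ((mdifferentiableWithinAt_extChartAt_symm hy1').mdifferentiableAt (Filter.mem_of_superset
        ((isOpen_extChartAt_target z₀.proj).mem_nhds hy1')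
        (extChartAt_target_subset_range z₀.proj)))
      (mdifferentiableAt_iff_differentiableAt.2 differentiableAt_fst),
      mfderiv_eq_fderiv, fderiv_fst]
    rfl
  rw [TangentBundle.symmL_trivializationAt hx, hy1] at hy2
  rw [hy2]
  have := congrArg (fun A => z.snd (A u)) (hd.symm.trans hd')
  simp only [modelWithCornersSelf_coe, range_id, mfderivWithin_univ]
  exact this

/-- In the canonical coordinates given by the chart at `z`, `ω = ∑ dqⁱ ∧ dpᵢ`. -/
theorem symplecticForm_apply (z : CotangentBundle E M)
    (X Y : TangentSpace (cotangentModel E) z) :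
    symplecticForm z X Y = (Y : E × (E →L[ℝ] ℝ)).2 (X : E × (E →L[ℝ] ℝ)).1
      - (X : E × (E →L[ℝ] ℝ)).2 (Y : E × (E →L[ℝ] ℝ)).1 := by
  have h1 : mfderiv (cotangentModel E) 𝓘(ℝ, E × (E →L[ℝ] ℝ)) (extChartAt (cotangentModel E) z) z =
     ContinuousLinearMap.id ℝ _ := mfderiv_extChartAt_self
  have h2 : HasFDerivAt (liouvilleInChart z)
    (((ContinuousLinearMap.compL ℝ (E × (E →L[ℝ] ℝ)) E ℝ).flip (ContinuousLinearMap.fst ℝ _ _)).comp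
      (ContinuousLinearMap.snd ℝ E (E →L[ℝ] ℝ)))
      (extChartAt (cotangentModel E) z z) := by
    have := (((ContinuousLinearMap.compL ℝ (E × (E →L[ℝ] ℝ)) E ℝ).flip (ContinuousLinearMap.fst ℝ _ _)).comp
      (ContinuousLinearMap.snd ℝ E (E →L[ℝ] ℝ))).hasFDerivAt (x := extChartAt (cotangentModel E) z z)
    refine this.congr_of_eventuallyEq ?_
    filter_upwards [extChartAt_target_mem_nhds (I := cotangentModel E) z] with y hy
    ext u <;> simp [liouvilleInChart_apply z hy]
  rw [symplecticForm, h2.fderiv, h1]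
  rfl

/-- The Hamiltonian vector field of `F : T*M → ℝ`: the vector field `X` on `T*M` determined by
`ω (X, Y) = dF (Y)` for all `Y`. -/
def hamiltonianVectorField (F : CotangentBundle E M → ℝ) (z : CotangentBundle E M) :
    TangentSpace (cotangentModel E) z :=
  Classical.epsilon fun X => ∀ Y : TangentSpace (cotangentModel E) z,
    symplecticForm z X Y = mvfderiv (cotangentModel E) F z Y

end Cotangent

/-! ### Sub-Riemannian structures, their Hamiltonians and geodesics

A sub-Riemannian structure is a family `D` of subspaces of the tangent spaces, with a family `gD`
of inner products. Only the values of `gD x` on vectors of `D x` are used. -/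

section SubRiemannian

variable {E : Type*} [NormedAddCommGroup E] [NormedSpace ℝ E]
  {M : Type*} [TopologicalSpace M] [ChartedSpace E M]

/-- The sharp map: `♯λ` is the vector of `D x` with `λ w = gD (♯λ, w)` for all `w ∈ D x`. -/
def sharp (D : (x : M) → Set (TangentSpace 𝓘(ℝ, E) x))
    (gD : (x : M) → TangentSpace 𝓘(ℝ, E) x → TangentSpace 𝓘(ℝ, E) x → ℝ)
    (x : M) (p : TangentSpace 𝓘(ℝ, E) x →L[ℝ] ℝ) : TangentSpace 𝓘(ℝ, E) x :=
  Classical.epsilon fun v => v ∈ D x ∧ ∀ w ∈ D x, p w = gD x v w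

variable [IsManifold 𝓘(ℝ, E) ∞ M]

/-- The sub-Riemannian Hamiltonian `H(x, λ) = ½ gD* (λ, λ) = ½ gD (♯λ, ♯λ)`. -/
def hamiltonian (D : (x : M) → Set (TangentSpace 𝓘(ℝ, E) x))
    (gD : (x : M) → TangentSpace 𝓘(ℝ, E) x → TangentSpace 𝓘(ℝ, E) x → ℝ)
    (z : CotangentBundle E M) : ℝ :=
  (1 / 2 : ℝ) * gD z.proj (sharp D gD z.proj z.snd) (sharp D gD z.proj z.snd)

/-- `γ` is, on the time interval `(a, b)`, the sub-Riemannian geodesic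
`t ↦ Π (exp (t X_H) z)` of `(M, D, gD)` with initial covector `z`: the projection to `M` of the
integral curve through `z` of the Hamiltonian vector field of the sub-Riemannian Hamiltonian. -/
def IsSubRiemannianGeodesic (D : (x : M) → Set (TangentSpace 𝓘(ℝ, E) x))
    (gD : (x : M) → TangentSpace 𝓘(ℝ, E) x → TangentSpace 𝓘(ℝ, E) x → ℝ)
    (z : CotangentBundle E M) (a b : ℝ) (γ : ℝ → M) : Prop :=
  ∃ Z : ℝ → CotangentBundle E M,
    IsMIntegralCurveOn (I := cotangentModel E) Z
      (hamiltonianVectorField (hamiltonian D gD)) (Ioo a b) ∧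
    Z 0 = z ∧ ∀ t ∈ Ioo a b, γ t = cotangentProj (Z t)

end SubRiemannian

/-! ### Principal bundles -/

section Principal

variable {E F : Type*} [NormedAddCommGroup E] [NormedSpace ℝ E]
  [NormedAddCommGroup F] [NormedSpace ℝ F]
  {H : Type*} [Group H]
  {M : Type*} [TopologicalSpace M] [ChartedSpace E M] [MulAction Hᵐᵒᵖ M]
  {N : Type*} [TopologicalSpace N] [ChartedSpace F N]

variable (E F) in
/-- Let `H` act on `M` from the right (`m <• h` is the action of `h` on `m`). The map `π : M → N`
is a principal bundle for the subgroup `L` of `H` (the whole group if `L = ⊤`) if it is a surjective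
smooth submersion whose fibres are preserved by `L`, and `L` acts freely and transitively on each
fibre. -/
structure IsPrincipalBundle (L : Subgroup H) (π : M → N) : Prop where
  submersion : Manifold.IsSubmersion 𝓘(ℝ, E) 𝓘(ℝ, F) ∞ π
  surjective : Function.Surjective π
  fiber_iff : ∀ m m' : M, π m = π m' ↔ ∃ h ∈ L, m' = m <• h
  free : ∀ (m : M), ∀ h ∈ L, m <• h = m → h = 1

/-- The vertical space `ker dπ` at `m`. -/
def vertical (π : M → N) (m : M) : Submodule ℝ (TangentSpace 𝓘(ℝ, E) m) :=
  (mfderiv 𝓘(ℝ, E) 𝓘(ℝ, F) π m).ker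

end Principal

section Metric

variable {E : Type*} [NormedAddCommGroup E] [NormedSpace ℝ E]
  {M : Type*} [TopologicalSpace M] [ChartedSpace E M] [IsManifold 𝓘(ℝ, E) ∞ M]

variable (E M) in
/-- Smooth Riemannian metrics on `M`. -/
abbrev RiemannianMetricOn : Type _ :=
  Bundle.ContMDiffRiemannianMetric 𝓘(ℝ, E) ∞ E (fun x : M => TangentSpace 𝓘(ℝ, E) x)

/-- The metric `g` is invariant under the right action of `H`: every translation
`x ↦ x <• h` is an isometry. -/
def IsInvariant (H : Type*) [Group H] [MulAction Hᵐᵒᵖ M] (g : RiemannianMetricOn E M) : Prop :=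
  ∀ (h : H) (m : M) (v w : TangentSpace 𝓘(ℝ, E) m),
    g.inner (m <• h) (mfderiv 𝓘(ℝ, E) 𝓘(ℝ, E) (fun x : M => x <• h) m v)
      (mfderiv 𝓘(ℝ, E) 𝓘(ℝ, E) (fun x : M => x <• h) m w) = g.inner m v w

section Inertia

variable {EH : Type*} [NormedAddCommGroup EH] [NormedSpace ℝ EH]
  {H : Type*} [Group H] [TopologicalSpace H] [ChartedSpace EH H] [MulAction Hᵐᵒᵖ M]

/-- The fundamental vector `σ_m(ξ) = d/dt|₀ m.exp(tξ)`, that is, the image of `ξ ∈ 𝔥 = T₁H` under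
the derivative at `1` of the orbit map `h ↦ m.h`. It is a tangent vector at `m.1 = m`. -/
def fundamentalVector (m : M) (ξ : GroupLieAlgebra 𝓘(ℝ, EH) H) :
    TangentSpace 𝓘(ℝ, E) (m <• (1 : H)) :=
  mfderiv 𝓘(ℝ, EH) 𝓘(ℝ, E) (fun h : H => m <• h) 1 ξ

/-- The bilinear form `𝕀_m(ξ, η) = g (σ_m ξ, σ_m η)` on the Lie algebra `𝔥`. -/
def inertia (g : RiemannianMetricOn E M) (m : M) (ξ η : GroupLieAlgebra 𝓘(ℝ, EH) H) : ℝ :=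
  g.inner (m <• (1 : H)) (fundamentalVector m ξ) (fundamentalVector m η)

end Inertia

variable {F : Type*} [NormedAddCommGroup F] [NormedSpace ℝ F]
  {N : Type*} [TopologicalSpace N] [ChartedSpace F N]

/-- The Ehresmann connection of `π` given by the metric: the orthogonal complement of the
vertical space `ker dπ`. -/
def horizontal (g : RiemannianMetricOn E M) (π : M → N) (m : M) :
    Submodule ℝ (TangentSpace 𝓘(ℝ, E) m) where
  carrier := {v | ∀ w ∈ vertical (F := F) π m, g.inner m v w = 0}
  add_mem' := by
    intro v v' hv hv' w hw
    simp only [mem_ofPred_eq] at hv hv'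
    rw [map_add, add_apply, hv w hw, hv' w hw, add_zero]
  zero_mem' := by
    intro w _
    rw [map_zero, zero_apply]
  smul_mem' := by
    intro c v hv w hw
    simp only [mem_ofPred_eq] at hv
    rw [map_smul, smul_apply, hv w hw, smul_zero]

/-- The distribution of the horizontal spaces of `π`. -/
def horizontalDistribution (g : RiemannianMetricOn E M) (π : M → N) (m : M) :
    Set (TangentSpace 𝓘(ℝ, E) m) :=
  horizontal (F := F) g π m

/-- The metric `g` as a family of real-valued functions of two tangent vectors. -/
def metricForm (g : RiemannianMetricOn E M) (m : M) (v w : TangentSpace 𝓘(ℝ, E) m) : ℝ :=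
  g.inner m v w

/-- The covector `π* μ` at `m`, given by `(π* μ)(v) = μ (dπ_m v)`, as a point of `T*M`. -/
def pullbackCovector (π : M → N) (m : M) (μ : TangentSpace 𝓘(ℝ, F) (π m) →L[ℝ] ℝ) :
    CotangentBundle E M :=
  ⟨m, μ.comp (mfderiv 𝓘(ℝ, E) 𝓘(ℝ, F) π m)⟩

/-- The image `dπ(D)` of a distribution `D` on `M`, as a distribution on the target of `π : M → N`:
at `n` it consists of the vectors `dπ_m(v)` with `π m = n` and `v ∈ D m`. -/
def pushDistribution (π : M → N) (D : (m : M) → Set (TangentSpace 𝓘(ℝ, E) m)) (n : N) :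
    Set (TangentSpace 𝓘(ℝ, F) n) :=
  {a | ∃ (m : M) (v : TangentSpace 𝓘(ℝ, E) m), v ∈ D m ∧
    tangentMap 𝓘(ℝ, E) 𝓘(ℝ, F) π ⟨m, v⟩ = ⟨n, a⟩}

/-- `r` is the value `g_m(v, w)` for some `m` over `n` and some horizontal lifts `v, w` at `m` of
the vectors `a, b` at `n`. -/
def IsHorizontalValue (g : RiemannianMetricOn E M) (π : M → N) (n : N)
    (a b : TangentSpace 𝓘(ℝ, F) n) (r : ℝ) : Prop :=
  ∃ (m : M) (v w : TangentSpace 𝓘(ℝ, E) m),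
    v ∈ horizontal (F := F) g π m ∧ w ∈ horizontal (F := F) g π m ∧
    tangentMap 𝓘(ℝ, E) 𝓘(ℝ, F) π ⟨m, v⟩ = ⟨n, a⟩ ∧
    tangentMap 𝓘(ℝ, E) 𝓘(ℝ, F) π ⟨m, w⟩ = ⟨n, b⟩ ∧ g.inner m v w = r

/-- The metric on the base `N` of a principal bundle `π : M → N` determined by
`gN (dπ v, dπ w) = g (v, w)` for horizontal `v, w`; see `quotientMetric_apply`. -/
def quotientMetric (g : RiemannianMetricOn E M) (π : M → N) (n : N)
    (a b : TangentSpace 𝓘(ℝ, F) n) : ℝ :=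
  Classical.epsilon (IsHorizontalValue g π n a b)

end Metric

section WellDefined

variable {E F : Type*} [NormedAddCommGroup E] [NormedSpace ℝ E]
  [NormedAddCommGroup F] [NormedSpace ℝ F]
  {H : Type*} [Group H]
  {M : Type*} [TopologicalSpace M] [ChartedSpace E M] [MulAction Hᵐᵒᵖ M]
  {N : Type*} [TopologicalSpace N] [ChartedSpace F N]

/-- A translation by an element of `L` commutes with `π`, on the level of derivatives. -/
theorem tangentMap_translate {L : Subgroup H} {π : M → N}
    (hπ : IsPrincipalBundle E F L π)
    (hact : ∀ h : H, ContMDiff 𝓘(ℝ, E) 𝓘(ℝ, E) ∞ (fun x : M => x <• h))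
    {h : H} (hh : h ∈ L) (m : M) (v : TangentSpace 𝓘(ℝ, E) m) :
    tangentMap 𝓘(ℝ, E) 𝓘(ℝ, F) π
      ⟨m <• h, mfderiv 𝓘(ℝ, E) 𝓘(ℝ, E) (fun x : M => x <• h) m v⟩ =
    tangentMap 𝓘(ℝ, E) 𝓘(ℝ, F) π ⟨m, v⟩ := by
  have hd : MDifferentiable 𝓘(ℝ, E) 𝓘(ℝ, F) π :=
    hπ.submersion.contMDiff.mdifferentiable (by simp)
  have ht : MDifferentiable 𝓘(ℝ, E) 𝓘(ℝ, E) (fun x : M => x <• h) :=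
    (hact h).mdifferentiable (by simp)
  have hc : π ∘ (fun x : M => x <• h) = π := by
    funext x
    exact ((hπ.fiber_iff x (x <• h)).2 ⟨h, hh, rfl⟩).symm
  have := tangentMap_comp_at (p := (⟨m, v⟩ : TangentBundle 𝓘(ℝ, E) M)) (hd (m <• h)) (ht m)
  rw [hc] at this
  exact this.symm

variable [IsManifold 𝓘(ℝ, E) ∞ M]

/-- The vertical and the horizontal space meet in `0`. -/
theorem eq_of_horizontal {g : RiemannianMetricOn E M} {π : M → N} {m : M}
    {v v' : TangentSpace 𝓘(ℝ, E) m} (hv : v ∈ horizontal (F := F) g π m)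
    (hv' : v' ∈ horizontal (F := F) g π m)
    (h : tangentMap 𝓘(ℝ, E) 𝓘(ℝ, F) π ⟨m, v⟩ = tangentMap 𝓘(ℝ, E) 𝓘(ℝ, F) π ⟨m, v'⟩) :
    v = v' := by
  have h1 : mfderiv 𝓘(ℝ, E) 𝓘(ℝ, F) π m v = mfderiv 𝓘(ℝ, E) 𝓘(ℝ, F) π m v' :=
    eq_of_heq (Bundle.TotalSpace.ext_iff.1 h).2
  have h2 : v - v' ∈ vertical (F := F) π m := by
    change mfderiv 𝓘(ℝ, E) 𝓘(ℝ, F) π m (v - v') = 0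
    rw [map_sub, h1, sub_self]
  by_contra hne
  exact (g.pos m (v - v') (sub_ne_zero.2 hne)).ne' ((Submodule.sub_mem _ hv hv') _ h2)

/-- A translation by an element of `L` preserves the horizontal spaces of `π`. -/
theorem translate_mem_horizontal [FiniteDimensional ℝ E] {L : Subgroup H} {π : M → N}
    (hπ : IsPrincipalBundle E F L π)
    (hact : ∀ h : H, ContMDiff 𝓘(ℝ, E) 𝓘(ℝ, E) ∞ (fun x : M => x <• h))
    {g : RiemannianMetricOn E M} (hg : IsInvariant H g)
    {h : H} (hh : h ∈ L) {m : M} {v : TangentSpace 𝓘(ℝ, E) m}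
    (hv : v ∈ horizontal (F := F) g π m) :
    mfderiv 𝓘(ℝ, E) 𝓘(ℝ, E) (fun x : M => x <• h) m v ∈ horizontal (F := F) g π (m <• h) := by
  intro w hw
  let A : E →ₗ[ℝ] E := (mfderiv 𝓘(ℝ, E) 𝓘(ℝ, E) (fun x : M => x <• h) m).toLinearMap
  have hA : Function.Injective A := by
    rw [← LinearMap.ker_eq_bot, LinearMap.ker_eq_bot']
    intro u hu
    by_contra hne
    have h1 := hg h m u u
    have h2 : mfderiv 𝓘(ℝ, E) 𝓘(ℝ, E) (fun x : M => x <• h) m u = 0 := hu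
    rw [h2, map_zero] at h1
    exact (g.pos m u hne).ne h1
  obtain ⟨u, hu⟩ := LinearMap.injective_iff_surjective.1 hA w
  have hu' : mfderiv 𝓘(ℝ, E) 𝓘(ℝ, E) (fun x : M => x <• h) m u = w := hu
  rw [← hu']
  rw [hg h m v u]
  refine hv u ?_
  have h3 := tangentMap_translate hπ hact hh m u
  rw [hu'] at h3
  have h4 : mfderiv 𝓘(ℝ, E) 𝓘(ℝ, F) π (m <• h) w = 0 := hw
  have h5 := (Bundle.TotalSpace.ext_iff.1 h3).2
  have h6 : π (m <• h) = π m := (Bundle.TotalSpace.ext_iff.1 h3).1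
  change HEq (mfderiv 𝓘(ℝ, E) 𝓘(ℝ, F) π (m <• h) w) (mfderiv 𝓘(ℝ, E) 𝓘(ℝ, F) π m u) at h5
  rw [h4] at h5
  exact (eq_of_heq h5).symm

/-- The metric `quotientMetric` is well defined: it makes `dπ` an isometry from each horizontal
space onto the tangent space of the base. -/
theorem quotientMetric_apply [FiniteDimensional ℝ E] {L : Subgroup H} {π : M → N}
    (hπ : IsPrincipalBundle E F L π)
    (hact : ∀ h : H, ContMDiff 𝓘(ℝ, E) 𝓘(ℝ, E) ∞ (fun x : M => x <• h))
    {g : RiemannianMetricOn E M} (hg : IsInvariant H g) (m : M)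
    {v w : TangentSpace 𝓘(ℝ, E) m} (hv : v ∈ horizontal (F := F) g π m)
    (hw : w ∈ horizontal (F := F) g π m) :
    quotientMetric g π (π m) (mfderiv 𝓘(ℝ, E) 𝓘(ℝ, F) π m v) (mfderiv 𝓘(ℝ, E) 𝓘(ℝ, F) π m w) =
      g.inner m v w := by
  obtain ⟨m', v', w', hv', hw', hv1, hw1, hr⟩ := Classical.epsilon_spec
    (p := IsHorizontalValue g π (π m) (mfderiv 𝓘(ℝ, E) 𝓘(ℝ, F) π m v)
      (mfderiv 𝓘(ℝ, E) 𝓘(ℝ, F) π m w)) ⟨g.inner m v w, m, v, w, hv, hw, rfl, rfl, rfl⟩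
  have hm : π m = π m' := (Bundle.TotalSpace.ext_iff.1 hv1).1.symm
  obtain ⟨h, hh, rfl⟩ := (hπ.fiber_iff m m').1 hm
  have e1 := eq_of_horizontal (translate_mem_horizontal hπ hact hg hh hv) hv'
    ((tangentMap_translate hπ hact hh m v).trans hv1.symm)
  have e2 := eq_of_horizontal (translate_mem_horizontal hπ hact hg hh hw) hw'
    ((tangentMap_translate hπ hact hh m w).trans hw1.symm)
  rw [← e1, ← e2, hg h m v w] at hr
  exact hr.symm

end WellDefined

section NestedProjection

variable {E EK EH : Type*} [NormedAddCommGroup E] [NormedSpace ℝ E]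
  [NormedAddCommGroup EK] [NormedSpace ℝ EK] [NormedAddCommGroup EH] [NormedSpace ℝ EH]
  {H : Type*} [Group H]
  {M : Type*} [TopologicalSpace M] [ChartedSpace E M] [MulAction Hᵐᵒᵖ M]
  {NK : Type*} [TopologicalSpace NK] [ChartedSpace EK NK]
  {NH : Type*} [TopologicalSpace NH] [ChartedSpace EH NH]

/-- The map `π : M/K → M/H` induced by `π_H : M → M/H` on the base of the bundle `π_K : M → M/K`:
a point `π_K m` is sent to `π_H m`; see `nestedProj_apply`. -/
def nestedProj (πK : M → NK) (πH : M → NH) (hK : Function.Surjective πK) (n : NK) : NH :=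
  πH (Function.surjInv hK n)

theorem nestedProj_apply {L L' : Subgroup H} (hL : L ≤ L') {πK : M → NK} {πH : M → NH}
    (hK : IsPrincipalBundle E EK L πK) (hH : IsPrincipalBundle E EH L' πH) (m : M) :
    nestedProj πK πH hK.surjective (πK m) = πH m := by
  obtain ⟨h, hh, hm⟩ :=
    (hK.fiber_iff (Function.surjInv hK.surjective (πK m)) m).1 (Function.surjInv_eq _ _)
  exact (hH.fiber_iff _ m).2 ⟨h, hL hh, hm⟩

end NestedProjection

end NestedBundle

end

/-! Let `C ⊆ T*M` be the set of covectors `ν ∘ dπ_K`, with `ν` a covector of `M/K`. It is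
coisotropic and projects to `T*(M/K)` by `ν ∘ dπ_K ↦ ν`. Since `D_H ⊆ D_K` and `dπ_K` is isometric
on `D_K`, the sharp vectors of `ν ∘ dπ_K` and `ν` correspond under `dπ_K`, so the Hamiltonian of `M`
restricted to `C` is the pull-back of that of `M/K` (`hamiltonian_push_eq`). A Hamiltonian whose
restriction to `C` is pulled back from the base has its vector field tangent to `C` and projecting
to the Hamiltonian vector field of the base. Hence integral curves that start at related covectors
stay related. This gives even `π_K γ = γ_D`, and `π` is then applied to both sides.

In submersion charts `π_K` is a linear map `R` with right inverse `L`, `C` is `{(q, p ∘ R)}`, and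
tangency and projection are the chain rule for `f (q, p ∘ R) = h (R q, p)`
(`coisotropicIncl_coisotropicVec`, `coisotropicProj_coisotropicVec`). One ODE on `E × F*` then
yields a related pair of local curves (`exists_local_integralCurves`); uniqueness and an open-closed
argument cover the whole interval (`isPullback_of_isMIntegralCurveOn`).

Two preparations are needed. The symplectic form is defined through one chart per point, so
Hamilton's equations must be transferred to lifts of arbitrary charts (`IsCanonicalOn`). Uniqueness
needs smooth Hamiltonians although the sharp map is a choice: on `M` an explicit formula gives this,
on `M/K` local sections do. -/

noncomputable section

namespace NestedBundle

open Filter Topology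

/-! ### Exact symplectic maps of `E × E*`. -/

section Calculus

variable {E : Type*} [NormedAddCommGroup E] [NormedSpace ℝ E]

/-- A map of `E × E*` that preserves the tautological one-form preserves the symplectic form. -/
theorem symplectic_of_preserves_liouville {Φ : E × (E →L[ℝ] ℝ) → E × (E →L[ℝ] ℝ)}
    {y : E × (E →L[ℝ] ℝ)} (hΦ : ContDiffAt ℝ ∞ Φ y)
    (h : ∀ᶠ y' in 𝓝 y, ∀ u, (Φ y').2 (fderiv ℝ Φ y' u).1 = y'.2 u.1)
    (X Y : E × (E →L[ℝ] ℝ)) :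
    (fderiv ℝ Φ y Y).2 (fderiv ℝ Φ y X).1 - (fderiv ℝ Φ y X).2 (fderiv ℝ Φ y Y).1 =
      Y.2 X.1 - X.2 Y.1 := by
  have hd : DifferentiableAt ℝ Φ y := hΦ.differentiableAt (by simp)
  have hd2 : DifferentiableAt ℝ (fderiv ℝ Φ) y :=
    (hΦ.fderiv_right (m := 1) (by norm_cast)).differentiableAt (by simp)
  have hs : IsSymmSndFDerivAt ℝ Φ y := hΦ.isSymmSndFDerivAt (by simp; norm_cast)
  -- The hypothesis differentiated in the direction `w`. The second-derivative term is symmetric in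
  -- `u, w`, so it disappears on antisymmetrizing.
  have key : ∀ u w : E × (E →L[ℝ] ℝ), (fderiv ℝ Φ y w).2 (fderiv ℝ Φ y u).1
      + (Φ y).2 (fderiv ℝ (fderiv ℝ Φ) y w u).1 = w.2 u.1 := by
    intro u w
    have h1 : HasFDerivAt (fun y' => (Φ y').2) ((ContinuousLinearMap.snd ℝ _ _).comp (fderiv ℝ Φ y)) y :=
      hd.hasFDerivAt.snd
    have h2 : HasFDerivAt (fun y' => (fderiv ℝ Φ y' u).1) ((ContinuousLinearMap.fst ℝ _ _).comp
        ((fderiv ℝ (fderiv ℝ Φ) y).flip u)) y := by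
      have := (hd2.hasFDerivAt.clm_apply (hasFDerivAt_const u y)).fst
      simpa using this
    have h3 := h1.clm_apply h2
    have h4 : HasFDerivAt (fun y' : E × (E →L[ℝ] ℝ) => y'.2 u.1)
        ((ContinuousLinearMap.apply ℝ ℝ u.1).comp (ContinuousLinearMap.snd ℝ E (E →L[ℝ] ℝ))) y :=
      ((ContinuousLinearMap.apply ℝ ℝ u.1).comp (ContinuousLinearMap.snd ℝ E (E →L[ℝ] ℝ))).hasFDerivAt
    have h5 := h3.unique (h4.congr_of_eventuallyEq (h.mono fun y' hy' => hy' u))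
    have h6 := DFunLike.congr_fun h5 w
    simp at h6
    linarith
  have k1 := key X Y
  have k2 := key Y X
  rw [hs.eq Y X] at k1
  linarith

end Calculus

/-! ### Hamilton's equations on `E × E*`. -/

theorem finrank_dual_eq (V : Type*) [NormedAddCommGroup V] [NormedSpace ℝ V]
    [FiniteDimensional ℝ V] : Module.finrank ℝ V = Module.finrank ℝ (V →L[ℝ] ℝ) := by
  rw [← LinearEquiv.finrank_eq (LinearMap.toContinuousLinearMap (𝕜 := ℝ) (E := V) (F' := ℝ))]
  exact (Subspace.dual_finrank_eq (K := ℝ) (V := V)).symm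

section HamVec

variable {E : Type*} [NormedAddCommGroup E] [NormedSpace ℝ E] [FiniteDimensional ℝ E]

variable (E) in
/-- The canonical isomorphism of a finite-dimensional space onto its bidual. -/
def bidualEquiv : E ≃L[ℝ] ((E →L[ℝ] ℝ) →L[ℝ] ℝ) :=
  (LinearMap.linearEquivOfInjective (NormedSpace.inclusionInDoubleDual ℝ E).toLinearMap
    (by
      intro x y hxy
      refine (SeparatingDual.eq_iff_forall_dual_eq (R := ℝ)).2 fun f => ?_
      exact DFunLike.congr_fun hxy f)
    ((finrank_dual_eq E).trans (finrank_dual_eq (E →L[ℝ] ℝ)))).toContinuousLinearEquiv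

@[simp] theorem bidualEquiv_apply (x : E) (p : E →L[ℝ] ℝ) : bidualEquiv E x p = p x := rfl

@[simp] theorem apply_bidualEquiv_symm (A : (E →L[ℝ] ℝ) →L[ℝ] ℝ) (p : E →L[ℝ] ℝ) :
    p ((bidualEquiv E).symm A) = A p := by
  rw [← bidualEquiv_apply, ContinuousLinearEquiv.apply_symm_apply]

/-- The Hamiltonian vector field of a function on `E × E*`, in canonical coordinates. -/
def hamVec (f : E × (E →L[ℝ] ℝ) → ℝ) (y : E × (E →L[ℝ] ℝ)) : E × (E →L[ℝ] ℝ) :=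
  ((bidualEquiv E).symm ((fderiv ℝ f y).comp (ContinuousLinearMap.inr ℝ E (E →L[ℝ] ℝ))),
    -(fderiv ℝ f y).comp (ContinuousLinearMap.inl ℝ E (E →L[ℝ] ℝ)))

/-- The coordinate form of `ω (X_f, Y) = df (Y)`, which fixes the signs in `hamVec`. -/
theorem hamVec_spec (f : E × (E →L[ℝ] ℝ) → ℝ) (y Y : E × (E →L[ℝ] ℝ)) :
    Y.2 (hamVec f y).1 - (hamVec f y).2 Y.1 = fderiv ℝ f y Y := by
  simp only [hamVec, apply_bidualEquiv_symm, ContinuousLinearMap.comp_apply, neg_apply,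
    ContinuousLinearMap.inr_apply, ContinuousLinearMap.inl_apply, sub_neg_eq_add]
  rw [← map_add]
  simp

theorem apply_hamVec_fst (f : E × (E →L[ℝ] ℝ) → ℝ) (y : E × (E →L[ℝ] ℝ)) (p : E →L[ℝ] ℝ) :
    p (hamVec f y).1 = fderiv ℝ f y (0, p) := by
  simpa using hamVec_spec f y (0, p)

theorem hamVec_snd_apply (f : E × (E →L[ℝ] ℝ) → ℝ) (y : E × (E →L[ℝ] ℝ)) (v : E) :
    (hamVec f y).2 v = -fderiv ℝ f y (v, 0) := by
  have := hamVec_spec f y (v, 0)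
  simp at this
  linarith

theorem contDiffAt_hamVec {f : E × (E →L[ℝ] ℝ) → ℝ} {y : E × (E →L[ℝ] ℝ)}
    (hf : ContDiffAt ℝ ∞ f y) : ContDiffAt ℝ ∞ (hamVec f) y := by
  have h : ContDiffAt ℝ ∞ (fderiv ℝ f) y := hf.fderiv_right (m := ∞) (by norm_cast)
  have h1 : ContDiffAt ℝ ∞ (fun y => (fderiv ℝ f y).comp
      (ContinuousLinearMap.inr ℝ E (E →L[ℝ] ℝ))) y := h.clm_comp contDiffAt_const
  have h2 : ContDiffAt ℝ ∞ (fun y => (fderiv ℝ f y).comp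
      (ContinuousLinearMap.inl ℝ E (E →L[ℝ] ℝ))) y := h.clm_comp contDiffAt_const
  exact ((bidualEquiv E).symm.contDiff.contDiffAt.comp y h1).prodMk h2.neg

end HamVec

/-! ### Hamiltonian vector fields on `T*M` in canonical coordinates. -/

section Nondegenerate

variable {E : Type*} [NormedAddCommGroup E] [NormedSpace ℝ E]
  {M : Type*} [TopologicalSpace M] [ChartedSpace E M] [IsManifold 𝓘(ℝ, E) ∞ M]

/-- Nondegeneracy of `ω`: vectors `(0, p)` test the base component against all linear forms, vectors
`(v, 0)` evaluate the fibre component. -/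
theorem eq_of_forall_symplecticForm_eq {z : CotangentBundle E M}
    {X X' : TangentSpace (cotangentModel E) z}
    (h : ∀ Y : TangentSpace (cotangentModel E) z, symplecticForm z X Y = symplecticForm z X' Y) :
    X = X' := by
  simp only [symplecticForm_apply] at h
  have h1 : (X : E × (E →L[ℝ] ℝ)).1 = (X' : E × (E →L[ℝ] ℝ)).1 := by
    refine (SeparatingDual.eq_iff_forall_dual_eq (R := ℝ)).2 fun p => ?_
    have := h ((0, p) : E × (E →L[ℝ] ℝ))
    simpa using this
  have h2 : (X : E × (E →L[ℝ] ℝ)).2 = (X' : E × (E →L[ℝ] ℝ)).2 := by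
    ext v
    have := h ((v, 0) : E × (E →L[ℝ] ℝ))
    simpa using this
  exact Prod.ext h1 h2

/-- The field is a choice; by nondegeneracy any exhibited solution is the chosen one. -/
theorem hamiltonianVectorField_eq {F : CotangentBundle E M → ℝ} {z : CotangentBundle E M}
    {X : TangentSpace (cotangentModel E) z}
    (h : ∀ Y : TangentSpace (cotangentModel E) z,
      symplecticForm z X Y = mvfderiv (cotangentModel E) F z Y) :
    hamiltonianVectorField F z = X := by
  have := Classical.epsilon_spec (p := fun X => ∀ Y : TangentSpace (cotangentModel E) z,
    symplecticForm z X Y = mvfderiv (cotangentModel E) F z Y) ⟨X, h⟩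
  exact eq_of_forall_symplecticForm_eq fun Y => (this Y).trans (h Y).symm

/-- `Λ` is a smooth map from an open subset of `E × E*` to `T*M` that pulls the tautological
one-form back to `∑ pᵢ dqⁱ`. -/
structure IsCanonicalOn (Λ : E × (E →L[ℝ] ℝ) → CotangentBundle E M)
    (U : Set (E × (E →L[ℝ] ℝ))) : Prop where
  isOpen : IsOpen U
  contMDiffOn : ContMDiffOn 𝓘(ℝ, E × (E →L[ℝ] ℝ)) (cotangentModel E) ∞ Λ U
  liouville : ∀ y ∈ U, ∀ u : E × (E →L[ℝ] ℝ), liouvilleForm (Λ y)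
    (mfderiv 𝓘(ℝ, E × (E →L[ℝ] ℝ)) (cotangentModel E) Λ y u) = y.2 u.1

namespace IsCanonicalOn

variable {Λ : E × (E →L[ℝ] ℝ) → CotangentBundle E M} {U : Set (E × (E →L[ℝ] ℝ))}
  (hΛ : IsCanonicalOn Λ U) {y : E × (E →L[ℝ] ℝ)}

include hΛ

theorem contMDiffAt (hy : y ∈ U) :
    ContMDiffAt 𝓘(ℝ, E × (E →L[ℝ] ℝ)) (cotangentModel E) ∞ Λ y :=
  hΛ.contMDiffOn.contMDiffAt (hΛ.isOpen.mem_nhds hy)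

theorem mdifferentiableAt (hy : y ∈ U) :
    MDifferentiableAt 𝓘(ℝ, E × (E →L[ℝ] ℝ)) (cotangentModel E) Λ y :=
  (hΛ.contMDiffAt hy).mdifferentiableAt (by simp)

/-- Read in the bundle chart at `Λ y`, the map `Λ` preserves `∑ pᵢ dqⁱ`, hence also its exterior
derivative. -/
theorem symplecticForm_mfderiv (hy : y ∈ U) (X Y : E × (E →L[ℝ] ℝ)) :
    symplecticForm (Λ y) (mfderiv 𝓘(ℝ, E × (E →L[ℝ] ℝ)) (cotangentModel E) Λ y X)
      (mfderiv 𝓘(ℝ, E × (E →L[ℝ] ℝ)) (cotangentModel E) Λ y Y) = Y.2 X.1 - X.2 Y.1 := by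
  set c := extChartAt (cotangentModel E) (Λ y) with hc
  set Φ : E × (E →L[ℝ] ℝ) → E × (E →L[ℝ] ℝ) := c ∘ Λ with hΦ
  have hsrc : ∀ᶠ y' in 𝓝 y, Λ y' ∈ c.source :=
    (hΛ.contMDiffAt hy).continuousAt.preimage_mem_nhds (extChartAt_source_mem_nhds _)
  have hΦs : ContDiffAt ℝ ∞ Φ y := by
    rw [← contMDiffAt_iff_contDiffAt]
    exact ContMDiffAt.comp y contMDiffAt_extChartAt (hΛ.contMDiffAt hy)
  -- The tangent space at `Λ y` is identified with the model through the chart at `Λ y` itself, so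
  -- this is the definition of `mfderiv`.
  have hmf : mfderiv 𝓘(ℝ, E × (E →L[ℝ] ℝ)) (cotangentModel E) Λ y = fderiv ℝ Φ y := by
    refine (hΛ.mdifferentiableAt hy).mfderiv.trans ?_
    change fderivWithin ℝ Φ (range id) y = fderiv ℝ Φ y
    rw [range_id, fderivWithin_univ]
  have hl : ∀ᶠ y' in 𝓝 y, ∀ u, (Φ y').2 (fderiv ℝ Φ y' u).1 = y'.2 u.1 := by
    filter_upwards [hsrc, hΛ.isOpen.mem_nhds hy, hsrc.eventually_nhds] with y' h1 h2 h3 u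
    have hΦd : DifferentiableAt ℝ Φ y' := by
      rw [← mdifferentiableAt_iff_differentiableAt]
      exact MDifferentiableAt.comp y' (mdifferentiableAt_extChartAt (by
        rw [hc, extChartAt_source] at h1; exact h1)) (hΛ.mdifferentiableAt h2)
    have ht : Φ y' ∈ c.target := c.map_source h1
    have hsymm : MDifferentiableAt 𝓘(ℝ, E × (E →L[ℝ] ℝ)) (cotangentModel E) c.symm (Φ y') :=
      (mdifferentiableWithinAt_extChartAt_symm ht).mdifferentiableAt (mem_of_superset
        ((isOpen_extChartAt_target _).mem_nhds ht) (extChartAt_target_subset_range _))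
    have he : c.symm ∘ Φ =ᶠ[𝓝 y'] Λ := h3.mono fun w hw => c.left_inv hw
    have hmd := mfderiv_comp y' hsymm hΦd.mdifferentiableAt
    rw [he.mfderiv_eq] at hmd
    have h4 := hΛ.liouville y' h2 u
    rw [← liouvilleInChart_apply (Λ y) ht, ← h4, hmd, liouvilleInChart]
    have h5 : c.symm (Φ y') = Λ y' := c.left_inv h1
    rw [mfderiv_eq_fderiv]
    change liouvilleForm (c.symm (Φ y')) _ = liouvilleForm (Λ y') _
    rw [h5]
    rfl
  refine (symplecticForm_apply _ _ _).trans ?_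
  rw [hmf]
  exact symplectic_of_preserves_liouville hΦs hl X Y

/-- A linear map that pulls a form back to a nondegenerate one has no kernel. -/
theorem mfderiv_injective (hy : y ∈ U) :
    Function.Injective (mfderiv 𝓘(ℝ, E × (E →L[ℝ] ℝ)) (cotangentModel E) Λ y) := by
  intro X X' h
  have key : ∀ Y : E × (E →L[ℝ] ℝ), Y.2 (X : E × (E →L[ℝ] ℝ)).1 - (X : E × (E →L[ℝ] ℝ)).2 Y.1 =
      Y.2 (X' : E × (E →L[ℝ] ℝ)).1 - (X' : E × (E →L[ℝ] ℝ)).2 Y.1 := by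
    intro Y
    refine (hΛ.symplecticForm_mfderiv hy X Y).symm.trans (Eq.trans ?_
      (hΛ.symplecticForm_mfderiv hy X' Y))
    exact congrArg (fun W => symplecticForm (Λ y) W _) h
  refine Prod.ext ((SeparatingDual.eq_iff_forall_dual_eq (R := ℝ)).2 fun p => ?_) ?_
  · simpa using key (0, p)
  · ext v
    simpa using key (v, 0)

variable [FiniteDimensional ℝ E]

theorem mfderiv_surjective (hy : y ∈ U) :
    Function.Surjective (mfderiv 𝓘(ℝ, E × (E →L[ℝ] ℝ)) (cotangentModel E) Λ y) := by
  let A : (E × (E →L[ℝ] ℝ)) →ₗ[ℝ] (E × (E →L[ℝ] ℝ)) :=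
    (mfderiv 𝓘(ℝ, E × (E →L[ℝ] ℝ)) (cotangentModel E) Λ y).toLinearMap
  exact LinearMap.injective_iff_surjective (f := A).1 (hΛ.mfderiv_injective hy)

/-- Hamilton's equations in canonical coordinates. -/
theorem hamiltonianVectorField_eq_mfderiv (hy : y ∈ U) {F : CotangentBundle E M → ℝ}
    (hF : MDifferentiableAt (cotangentModel E) 𝓘(ℝ, ℝ) F (Λ y)) :
    hamiltonianVectorField F (Λ y) =
      mfderiv 𝓘(ℝ, E × (E →L[ℝ] ℝ)) (cotangentModel E) Λ y (hamVec (F ∘ Λ) y) := by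
  refine hamiltonianVectorField_eq fun Y => ?_
  obtain ⟨Y, rfl⟩ := hΛ.mfderiv_surjective hy Y
  refine (hΛ.symplecticForm_mfderiv hy (hamVec (F ∘ Λ) y) Y).trans ?_
  refine (hamVec_spec (F ∘ Λ) y Y).trans ?_
  rw [← mfderiv_eq_fderiv, mfderiv_comp y hF (hΛ.mdifferentiableAt hy)]
  rfl

/-- Turns a solution of Hamilton's equations in `E × E*` into an integral curve on `T*M`; the
derivative has the shape demanded by `IsMIntegralCurveAt`. -/
theorem hasMFDerivAt_comp {F : CotangentBundle E M → ℝ} {c : ℝ → E × (E →L[ℝ] ℝ)} {t : ℝ}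
    (ht : c t ∈ U) (hF : MDifferentiableAt (cotangentModel E) 𝓘(ℝ, ℝ) F (Λ (c t)))
    (hc : HasDerivAt c (hamVec (F ∘ Λ) (c t)) t) :
    HasMFDerivAt 𝓘(ℝ, ℝ) (cotangentModel E) (Λ ∘ c) t
      ((1 : ℝ →L[ℝ] ℝ).smulRight (hamiltonianVectorField F ((Λ ∘ c) t))) := by
  have h := HasMFDerivAt.comp (I' := 𝓘(ℝ, E × (E →L[ℝ] ℝ))) t
    (hΛ.mdifferentiableAt ht).hasMFDerivAt hc.hasFDerivAt.hasMFDerivAt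
  refine h.congr_mfderiv ?_
  refine ContinuousLinearMap.ext_ring (R₁ := ℝ) (M₁ := E × (E →L[ℝ] ℝ)) ?_
  symm
  change (1 : ℝ) • hamiltonianVectorField F (Λ (c t)) = mfderiv 𝓘(ℝ, E × (E →L[ℝ] ℝ))
    (cotangentModel E) Λ (c t) ((1 : ℝ) • hamVec (F ∘ Λ) (c t))
  rw [one_smul, one_smul, hΛ.hamiltonianVectorField_eq_mfderiv ht hF]

end IsCanonicalOn

theorem isCanonicalOn_extChartAt_symm (z : CotangentBundle E M) :
    IsCanonicalOn (extChartAt (cotangentModel E) z).symm (extChartAt (cotangentModel E) z).target where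
  isOpen := isOpen_extChartAt_target z
  contMDiffOn := contMDiffOn_extChartAt_symm z
  liouville _ hy u := liouvilleInChart_apply z hy u

variable [FiniteDimensional ℝ E]

/-- In the chart `c` at `z₀` the field is `hamVec (F ∘ c.symm)`, which is smooth. This regularity is
what uniqueness of integral curves requires. -/
theorem contMDiff_hamiltonianVectorField {F : CotangentBundle E M → ℝ}
    (hF : ContMDiff (cotangentModel E) 𝓘(ℝ, ℝ) ∞ F) :
    ContMDiff (cotangentModel E) (cotangentModel E).tangent ∞
      (fun z => (⟨z, hamiltonianVectorField F z⟩ :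
        TangentBundle (cotangentModel E) (CotangentBundle E M))) := by
  intro z₀
  set c := extChartAt (cotangentModel E) z₀ with hc
  refine Bundle.contMDiffAt_totalSpace.2 ⟨contMDiffAt_id, ?_⟩
  have hΛ := isCanonicalOn_extChartAt_symm (E := E) (M := M) z₀
  have hs : c z₀ ∈ c.target := mem_extChartAt_target z₀
  have hG : ContDiffAt ℝ ∞ (F ∘ c.symm) (c z₀) := by
    rw [← contMDiffAt_iff_contDiffAt]
    exact hF.contMDiffAt.comp _ (hΛ.contMDiffAt hs)
  have h1 : ContMDiffAt (cotangentModel E) 𝓘(ℝ, E × (E →L[ℝ] ℝ)) ∞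
      (fun z => hamVec (F ∘ c.symm) (c z)) z₀ :=
    (contDiffAt_hamVec hG).contMDiffAt.comp z₀ contMDiffAt_extChartAt
  refine h1.congr_of_eventuallyEq ?_
  filter_upwards [extChartAt_source_mem_nhds (I := cotangentModel E) z₀] with z hz
  have hzc : z ∈ (chartAt (ModelProd E (E →L[ℝ] ℝ)) z₀).source := by
    rwa [extChartAt_source] at hz
  have ht : c z ∈ c.target := c.map_source hz
  have hcz : c.symm (c z) = z := c.left_inv hz
  have h2 := hΛ.hamiltonianVectorField_eq_mfderiv ht (F := F) (hF.mdifferentiable (by simp) _)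
  -- The trivialization of the tangent bundle at `z₀` is the derivative of the chart at `z₀`.
  have h3 : ((trivializationAt (E × (E →L[ℝ] ℝ)) (TangentSpace (cotangentModel E)) z₀)
      (⟨z, hamiltonianVectorField F z⟩ : TangentBundle (cotangentModel E) (CotangentBundle E M))).2
      = mfderiv (cotangentModel E) 𝓘(ℝ, E × (E →L[ℝ] ℝ)) c z (hamiltonianVectorField F z) := by
    have h4 := Bundle.Trivialization.continuousLinearMapAt_apply_of_mem (R := ℝ)
      (trivializationAt (E × (E →L[ℝ] ℝ)) (TangentSpace (cotangentModel E)) z₀)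
      (b := z) (by simpa using hzc) (hamiltonianVectorField F z)
    have h5 := TangentBundle.continuousLinearMapAt_trivializationAt (I := cotangentModel E) hzc
    exact h4.symm.trans (congrArg (fun A => A (hamiltonianVectorField F z)) h5)
  refine h3.trans ?_
  have h6 : MDifferentiableAt (cotangentModel E) 𝓘(ℝ, E × (E →L[ℝ] ℝ)) c (c.symm (c z)) := by
    rw [hcz]
    exact mdifferentiableAt_extChartAt hzc
  have h7 := mfderiv_comp (c z) h6 (hΛ.mdifferentiableAt ht)
  have h8 : c ∘ c.symm =ᶠ[𝓝 (c z)] id :=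
    ((isOpen_extChartAt_target z₀).mem_nhds ht |> mem_of_superset) fun w hw => c.right_inv hw
  rw [h8.mfderiv_eq, mfderiv_id] at h7
  have h9 := congrArg (fun A => A (hamVec (F ∘ c.symm) (c z))) h7
  have h10 : ∀ w : CotangentBundle E M, w = z →
      (mfderiv (cotangentModel E) 𝓘(ℝ, E × (E →L[ℝ] ℝ)) c w (hamiltonianVectorField F w) :
        E × (E →L[ℝ] ℝ)) =
      mfderiv (cotangentModel E) 𝓘(ℝ, E × (E →L[ℝ] ℝ)) c z (hamiltonianVectorField F z) := by
    rintro w rfl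
    rfl
  refine (h10 _ hcz).symm.trans ?_
  rw [h2]
  exact h9.symm

end Nondegenerate

/-! ### Smoothness of covector fields and of their pull-backs. -/

section Pullback

variable {E : Type*} [NormedAddCommGroup E] [NormedSpace ℝ E]
  {M : Type*} [TopologicalSpace M] [ChartedSpace E M] [IsManifold 𝓘(ℝ, E) ∞ M]
  {E' : Type*} [NormedAddCommGroup E'] [NormedSpace ℝ E']
  {M' : Type*} [TopologicalSpace M'] [ChartedSpace E' M'] [IsManifold 𝓘(ℝ, E') ∞ M']

/-- The covector `p` at `x`, read in the trivialization of the tangent bundle at `x₀`. -/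
def covectorInCoordinates (x₀ x : M) (p : TangentSpace 𝓘(ℝ, E) x →L[ℝ] ℝ) : E →L[ℝ] ℝ :=
  p.comp ((trivializationAt E (TangentSpace 𝓘(ℝ, E)) x₀).symmL ℝ x)

/-- The target line bundle is trivial, so only the source of the linear form needs a trivialization.
-/
theorem contMDiffAt_cotangent_iff {EQ HQ : Type*} [NormedAddCommGroup EQ] [NormedSpace ℝ EQ]
    [TopologicalSpace HQ] {IQ : ModelWithCorners ℝ EQ HQ} {Q : Type*} [TopologicalSpace Q]
    [ChartedSpace HQ Q] {n : WithTop ℕ∞} {f : Q → CotangentBundle E M} {q₀ : Q} :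
    ContMDiffAt IQ (cotangentModel E) n f q₀ ↔
      ContMDiffAt IQ 𝓘(ℝ, E) n (fun q => (f q).proj) q₀ ∧
      ContMDiffAt IQ 𝓘(ℝ, E →L[ℝ] ℝ) n
        (fun q => covectorInCoordinates (f q₀).proj (f q).proj (f q).snd) q₀ := by
  rw [contMDiffAt_hom_bundle]
  refine and_congr_right fun _ => ?_
  refine Filter.EventuallyEq.contMDiffAt_iff (Eventually.of_forall fun q => ?_)
  ext v
  simp [ContinuousLinearMap.inCoordinates, covectorInCoordinates]

/-- Between `p` and `A` one inserts the trivialization at `y₀` and its inverse, which cancel only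
over the chart domain; hence `hy`. -/
theorem covectorInCoordinates_comp {x₀ x : M} {y₀ y : M'}
    (hy : y ∈ (chartAt E' y₀).source)
    (A : TangentSpace 𝓘(ℝ, E) x →L[ℝ] TangentSpace 𝓘(ℝ, E') y)
    (p : TangentSpace 𝓘(ℝ, E') y →L[ℝ] ℝ) :
    covectorInCoordinates x₀ x (p.comp A) = (covectorInCoordinates y₀ y p).comp
      (ContinuousLinearMap.inCoordinates E (TangentSpace 𝓘(ℝ, E)) E' (TangentSpace 𝓘(ℝ, E'))
        x₀ x y₀ y A) := by
  ext v
  simp only [covectorInCoordinates, ContinuousLinearMap.inCoordinates]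
  change p (A _) = p _
  congr 1
  exact (Bundle.Trivialization.symmL_continuousLinearMapAt
    (trivializationAt E' (TangentSpace 𝓘(ℝ, E')) y₀) (by simpa using hy) _).symm

theorem covectorInCoordinates_injective {x₀ x : M} (hx : x ∈ (chartAt E x₀).source) :
    Function.Injective (covectorInCoordinates (E := E) x₀ x) := by
  intro p p' h
  ext v
  have h1 := Bundle.Trivialization.symmL_continuousLinearMapAt (R := ℝ)
    (trivializationAt E (TangentSpace 𝓘(ℝ, E)) x₀) (b := x) (by simpa using hx) v
  rw [← h1]
  exact DFunLike.congr_fun h _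

variable {EQ HQ : Type*} [NormedAddCommGroup EQ] [NormedSpace ℝ EQ]
    [TopologicalSpace HQ] {IQ : ModelWithCorners ℝ EQ HQ} {Q : Type*} [TopologicalSpace Q]
    [ChartedSpace HQ Q]

/-- Covectors depending smoothly on a parameter have a smooth pull-back. -/
theorem contMDiffAt_covector_comp_mfderiv [IsManifold IQ ∞ Q] {φ : M → M'} {f : Q → M}
    {w : ∀ q, TangentSpace 𝓘(ℝ, E') (φ (f q)) →L[ℝ] ℝ} {q₀ : Q}
    (hφ : ContMDiffAt 𝓘(ℝ, E) 𝓘(ℝ, E') ∞ φ (f q₀)) (hf : ContMDiffAt IQ 𝓘(ℝ, E) ∞ f q₀)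
    (hw : ContMDiffAt IQ (cotangentModel E') ∞
      (fun q => (⟨φ (f q), w q⟩ : CotangentBundle E' M')) q₀) :
    ContMDiffAt IQ (cotangentModel E) ∞ (fun q => (⟨f q,
      (w q).comp (mfderiv 𝓘(ℝ, E) 𝓘(ℝ, E') φ (f q))⟩ : CotangentBundle E M)) q₀ := by
  rw [contMDiffAt_cotangent_iff] at hw ⊢
  refine ⟨hf, ?_⟩
  have h1 : ContMDiffAt IQ 𝓘(ℝ, E →L[ℝ] E') ∞ (inTangentCoordinates 𝓘(ℝ, E) 𝓘(ℝ, E') f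
      (fun q => φ (f q)) (fun q => mfderiv 𝓘(ℝ, E) 𝓘(ℝ, E') φ (f q)) q₀) q₀ := by
    refine ContMDiffAt.mfderiv (n := ∞) (fun _ => φ) f ?_ hf (by norm_cast)
    exact ContMDiffAt.comp (q₀, f q₀) hφ contMDiffAt_snd
  refine (hw.2.clm_comp h1).congr_of_eventuallyEq ?_
  have h2 : ∀ᶠ q in 𝓝 q₀, φ (f q) ∈ (chartAt E' (φ (f q₀))).source :=
    hw.1.continuousAt.preimage_mem_nhds
      ((chartAt E' _).open_source.mem_nhds (mem_chart_source E' _))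
  filter_upwards [h2] with q hq
  exact covectorInCoordinates_comp hq _ _

end Pullback

/-! ### Canonical coordinates from an arbitrary chart. -/

section Lift

variable {E : Type*} [NormedAddCommGroup E] [NormedSpace ℝ E]
  {M : Type*} [TopologicalSpace M] [ChartedSpace E M] [IsManifold 𝓘(ℝ, E) ∞ M]

/-- The inverse of the chart of `T*M` induced by a chart `φ` of `M`. -/
def cotangentLift (φ : OpenPartialHomeomorph M E) (y : E × (E →L[ℝ] ℝ)) : CotangentBundle E M :=
  ⟨φ.symm y.1, (y.2 : TangentSpace 𝓘(ℝ, E) (φ (φ.symm y.1)) →L[ℝ] ℝ).comp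
    (mfderiv 𝓘(ℝ, E) 𝓘(ℝ, E) φ (φ.symm y.1))⟩

/-- The footpoint of the lift is `φ⁻¹ q`, so the Liouville form takes `u` to `p (dφ (dφ⁻¹ u.1)) = p
u.1`. Charts adapted to a submersion need not be preferred charts, hence the maximal atlas. -/
theorem isCanonicalOn_cotangentLift {φ : OpenPartialHomeomorph M E}
    (hφ : φ ∈ IsManifold.maximalAtlas 𝓘(ℝ, E) ∞ M) :
    IsCanonicalOn (cotangentLift φ) (φ.target ×ˢ univ) := by
  have hU : IsOpen (φ.target ×ˢ (univ : Set (E →L[ℝ] ℝ))) := φ.open_target.prod isOpen_univ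
  have hsm : ∀ y ∈ φ.target ×ˢ (univ : Set (E →L[ℝ] ℝ)), ContMDiffAt 𝓘(ℝ, E × (E →L[ℝ] ℝ))
      𝓘(ℝ, E) ∞ (fun y : E × (E →L[ℝ] ℝ) => φ.symm y.1) y := by
    intro y hy
    exact ContMDiffAt.comp y ((contMDiffOn_symm_of_mem_maximalAtlas hφ).contMDiffAt
      (φ.open_target.mem_nhds hy.1)) contDiff_fst.contMDiff.contMDiffAt
  have hsm' : ∀ y ∈ φ.target ×ˢ (univ : Set (E →L[ℝ] ℝ)),
      ContMDiffAt 𝓘(ℝ, E) 𝓘(ℝ, E) ∞ φ (φ.symm y.1) := by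
    intro y hy
    exact (contMDiffOn_of_mem_maximalAtlas hφ).contMDiffAt
      (φ.open_source.mem_nhds (φ.map_target hy.1))
  have hL : ∀ y ∈ φ.target ×ˢ (univ : Set (E →L[ℝ] ℝ)), ContMDiffAt 𝓘(ℝ, E × (E →L[ℝ] ℝ))
      (cotangentModel E) ∞ (cotangentLift φ) y := by
    intro y hy
    refine contMDiffAt_covector_comp_mfderiv (w := fun y : E × (E →L[ℝ] ℝ) => y.2)
      (hsm' y hy) (hsm y hy) ?_
    rw [contMDiffAt_cotangent_iff]
    have hb : ContMDiffAt 𝓘(ℝ, E × (E →L[ℝ] ℝ)) 𝓘(ℝ, E) ∞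
      (fun y : E × (E →L[ℝ] ℝ) => φ (φ.symm y.1)) y := ContMDiffAt.comp y (hsm' y hy) (hsm y hy)
    refine ⟨hb, ?_⟩
    refine contDiff_snd.contMDiff.contMDiffAt.congr_of_eventuallyEq
      (Eventually.of_forall fun w => ?_)
    simp only [covectorInCoordinates, TangentBundle.symmL_model_space]
    rfl
  refine ⟨hU, fun y hy => (hL y hy).contMDiffWithinAt, fun y hy u => ?_⟩
  have hp : MDifferentiableAt (cotangentModel E) 𝓘(ℝ, E) (cotangentProj (E := E) (M := M))
      (cotangentLift φ y) := (Bundle.contMDiff_proj _ (n := ∞)).mdifferentiable (by simp) _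
  have h1 := mfderiv_comp y hp ((hL y hy).mdifferentiableAt (by simp))
  have h2 := mfderiv_comp y ((hsm' y hy).mdifferentiableAt (by simp))
    ((hsm y hy).mdifferentiableAt (by simp))
  have h3 : φ ∘ (fun y : E × (E →L[ℝ] ℝ) => φ.symm y.1) =ᶠ[𝓝 y] Prod.fst := by
    filter_upwards [hU.mem_nhds hy] with w hw
    exact φ.right_inv hw.1
  rw [h3.mfderiv_eq, mfderiv_eq_fderiv, fderiv_fst] at h2
  have h4 := congrArg (fun A => y.2 (A u)) h2
  have h5 := congrArg (fun A => y.2 (mfderiv 𝓘(ℝ, E) 𝓘(ℝ, E) φ (φ.symm y.1) (A u))) h1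
  exact h5.symm.trans h4.symm

end Lift

/-! ### An explicit formula for the sharp map of `(ker A)^⊥`. -/

section LinearAlgebra

variable {E F : Type*} [NormedAddCommGroup E] [NormedSpace ℝ E]
  [NormedAddCommGroup F] [NormedSpace ℝ F]

/-- The transpose `p ↦ p ∘ A`, as a continuous linear function of `A`. -/
def transposeL (E F : Type*) [NormedAddCommGroup E] [NormedSpace ℝ E]
    [NormedAddCommGroup F] [NormedSpace ℝ F] :
    (E →L[ℝ] F) →L[ℝ] ((F →L[ℝ] ℝ) →L[ℝ] (E →L[ℝ] ℝ)) :=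
  (ContinuousLinearMap.compL ℝ E F ℝ).flip

/-- The form induced by the inner product `G` on the dual of the target of `A`. -/
def inducedForm (G : E →L[ℝ] E →L[ℝ] ℝ) (A : E →L[ℝ] F) : (F →L[ℝ] ℝ) →L[ℝ] F :=
  (A.comp G.inverse).comp (transposeL E F A)

/-- The sharp map of the `G`-orthogonal complement of `ker A`. -/
def horizontalSharp (G : E →L[ℝ] E →L[ℝ] ℝ) (A : E →L[ℝ] F) : (E →L[ℝ] ℝ) →L[ℝ] E :=
  ((G.inverse.comp (transposeL E F A)).comp (inducedForm G A).inverse).comp (A.comp G.inverse)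

theorem exists_equiv_of_injective {V W : Type*} [NormedAddCommGroup V] [NormedSpace ℝ V]
    [NormedAddCommGroup W] [NormedSpace ℝ W] [FiniteDimensional ℝ V] [FiniteDimensional ℝ W]
    (B : V →L[ℝ] W) (hB : Function.Injective B) (h : Module.finrank ℝ V = Module.finrank ℝ W) :
    ∃ e : V ≃L[ℝ] W, (e : V →L[ℝ] W) = B :=
  ⟨(LinearMap.linearEquivOfInjective B.toLinearMap hB h).toContinuousLinearEquiv, by ext; rfl⟩

variable [FiniteDimensional ℝ E] [FiniteDimensional ℝ F]
  {G : E →L[ℝ] E →L[ℝ] ℝ} {A : E →L[ℝ] F}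

theorem exists_equiv_of_pos (hpos : ∀ v, v ≠ 0 → 0 < G v v) :
    ∃ e : E ≃L[ℝ] (E →L[ℝ] ℝ), (e : E →L[ℝ] (E →L[ℝ] ℝ)) = G := by
  refine exists_equiv_of_injective G ?_ (finrank_dual_eq E)
  refine (injective_iff_map_eq_zero G).2 fun v hv => ?_
  by_contra hne
  have := hpos v hne
  rw [hv] at this
  simp at this

theorem apply_inverse_of_pos (hpos : ∀ v, v ≠ 0 → 0 < G v v) (p : E →L[ℝ] ℝ) :
    G (G.inverse p) = p := by
  obtain ⟨e, rfl⟩ := exists_equiv_of_pos hpos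
  simp

/-- If `A G⁻¹ (p ∘ A) = 0`, then `v = G⁻¹ (p ∘ A)` has `G v v = p (A v) = 0`; so `v = 0`, `p ∘ A =
0`, and `p = 0` as `A` is onto. -/
theorem exists_equiv_inducedForm (hpos : ∀ v, v ≠ 0 → 0 < G v v) (hA : Function.Surjective A) :
    ∃ e : (F →L[ℝ] ℝ) ≃L[ℝ] F, (e : (F →L[ℝ] ℝ) →L[ℝ] F) = inducedForm G A := by
  refine exists_equiv_of_injective _ ?_ (finrank_dual_eq F).symm
  refine (injective_iff_map_eq_zero (inducedForm G A)).2 fun p hp => ?_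
  set v := G.inverse (p.comp A) with hv
  have h1 : G v = p.comp A := apply_inverse_of_pos hpos _
  have h2 : A v = 0 := hp
  have h3 : v = 0 := by
    by_contra hne
    have := hpos v hne
    rw [h1] at this
    simp [h2] at this
  ext w
  obtain ⟨u, rfl⟩ := hA w
  have := DFunLike.congr_fun h1 u
  rw [h3] at this
  simpa using this.symm

omit [FiniteDimensional ℝ F] in
-- `G` of the vector has the form `ν ∘ A`, whatever value `inverse` takes on `inducedForm G A`; so
-- `A` need not be onto.
theorem horizontalSharp_mem (hpos : ∀ v, v ≠ 0 → 0 < G v v) (p : E →L[ℝ] ℝ) {w : E}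
    (hw : A w = 0) : G (horizontalSharp G A p) w = 0 := by
  have := apply_inverse_of_pos hpos (((inducedForm G A).inverse (A (G.inverse p))).comp A)
  change G (G.inverse (((inducedForm G A).inverse (A (G.inverse p))).comp A)) w = 0
  rw [this]
  simp [hw]

/-- The vector is the orthogonal projection of `G⁻¹ p`: both have the same image under `A`, so they
differ by an element of `ker A`, which is orthogonal to `w`. -/
theorem horizontalSharp_spec (hpos : ∀ v, v ≠ 0 → 0 < G v v) (hsymm : ∀ v w, G v w = G w v)
    (hA : Function.Surjective A) (p : E →L[ℝ] ℝ) {w : E}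
    (hw : ∀ u, A u = 0 → G w u = 0) : p w = G (horizontalSharp G A p) w := by
  obtain ⟨e, he⟩ := exists_equiv_inducedForm hpos hA
  have h1 : A (horizontalSharp G A p) = A (G.inverse p) := by
    change inducedForm G A ((inducedForm G A).inverse (A (G.inverse p))) = _
    rw [← he]
    simp
  have h2 := hw (G.inverse p - horizontalSharp G A p) (by rw [map_sub, h1, sub_self])
  rw [map_sub, sub_eq_zero, hsymm w, apply_inverse_of_pos hpos] at h2
  rw [h2, hsymm]

variable {EQ HQ : Type*} [NormedAddCommGroup EQ] [NormedSpace ℝ EQ]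
    [TopologicalSpace HQ] {IQ : ModelWithCorners ℝ EQ HQ} {Q : Type*} [TopologicalSpace Q]
    [ChartedSpace HQ Q]

theorem contMDiffAt_inverse {V W : Type*} [NormedAddCommGroup V] [NormedSpace ℝ V]
    [NormedAddCommGroup W] [NormedSpace ℝ W] [CompleteSpace V] {n : WithTop ℕ∞}
    {B : Q → V →L[ℝ] W} {q : Q} (hB : ContMDiffAt IQ 𝓘(ℝ, V →L[ℝ] W) n B q)
    (h : ∃ e : V ≃L[ℝ] W, (e : V →L[ℝ] W) = B q) :
    ContMDiffAt IQ 𝓘(ℝ, W →L[ℝ] V) n (fun q => (B q).inverse) q := by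
  obtain ⟨e, he⟩ := h
  have := contDiffAt_map_inverse (n := n) e
  rw [he] at this
  exact this.contMDiffAt.comp q hB

theorem contMDiffAt_horizontalSharp {n : WithTop ℕ∞} {G : Q → E →L[ℝ] E →L[ℝ] ℝ}
    {A : Q → E →L[ℝ] F} {q : Q} (hG : ContMDiffAt IQ 𝓘(ℝ, E →L[ℝ] E →L[ℝ] ℝ) n G q)
    (hA : ContMDiffAt IQ 𝓘(ℝ, E →L[ℝ] F) n A q) (hpos : ∀ v, v ≠ 0 → 0 < G q v v)
    (hs : Function.Surjective (A q)) :
    ContMDiffAt IQ 𝓘(ℝ, (E →L[ℝ] ℝ) →L[ℝ] E) n (fun q => horizontalSharp (G q) (A q)) q := by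
  have hGi := contMDiffAt_inverse hG (exists_equiv_of_pos hpos)
  have hT : ContMDiffAt IQ 𝓘(ℝ, (F →L[ℝ] ℝ) →L[ℝ] (E →L[ℝ] ℝ)) n
      (fun q => transposeL E F (A q)) q :=
    contMDiffAt_const.clm_apply hA
  have hI : ContMDiffAt IQ 𝓘(ℝ, (F →L[ℝ] ℝ) →L[ℝ] F) n
      (fun q => inducedForm (G q) (A q)) q := (hA.clm_comp hGi).clm_comp hT
  have hIi := contMDiffAt_inverse hI (exists_equiv_inducedForm hpos hs)
  exact ((hGi.clm_comp hT).clm_comp hIi).clm_comp (hA.clm_comp hGi)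

end LinearAlgebra

/-! ### Local normal form and sections of a submersion. -/

section Submersion

variable {E F : Type*} [NormedAddCommGroup E] [NormedSpace ℝ E]
  [NormedAddCommGroup F] [NormedSpace ℝ F]
  {M : Type*} [TopologicalSpace M] [ChartedSpace E M]
  {N : Type*} [TopologicalSpace N] [ChartedSpace F N]

/-- In suitable charts a submersion is a projection. -/
theorem exists_charts_of_isSubmersion {π : M → N}
    (hπ : Manifold.IsSubmersion 𝓘(ℝ, E) 𝓘(ℝ, F) ∞ π) (m : M) :
    ∃ (φ : OpenPartialHomeomorph M E) (χ : OpenPartialHomeomorph N F) (R : E →L[ℝ] F)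
      (L : F →L[ℝ] E), φ ∈ IsManifold.maximalAtlas 𝓘(ℝ, E) ∞ M ∧
      χ ∈ IsManifold.maximalAtlas 𝓘(ℝ, F) ∞ N ∧ (∀ a, R (L a) = a) ∧
      m ∈ φ.source ∧ π m ∈ χ.source ∧
      ∀ q ∈ φ.target, π (φ.symm q) ∈ χ.source ∧ χ (π (φ.symm q)) = R q := by
  have h := hπ.isSubmersionAt m
  refine ⟨h.domChart, h.codChart, (ContinuousLinearMap.fst ℝ _ _).comp h.equiv.toContinuousLinearMap,
    h.equiv.symm.toContinuousLinearMap.comp (ContinuousLinearMap.inl ℝ _ _),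
    h.domChart_mem_maximalAtlas, h.codChart_mem_maximalAtlas, by simp, h.mem_domChart_source,
    h.mem_codChart_source, fun q hq => ⟨h.source_subset_preimage_source
      (h.domChart.map_target hq), ?_⟩⟩
  exact h.writtenInCharts (by simpa using hq)

/-- A submersion has smooth local sections. -/
theorem exists_section_of_isSubmersion {π : M → N}
    (hπ : Manifold.IsSubmersion 𝓘(ℝ, E) 𝓘(ℝ, F) ∞ π) (m : M) :
    ∃ s : N → M, ContMDiffAt 𝓘(ℝ, F) 𝓘(ℝ, E) ∞ s (π m) ∧ s (π m) = m ∧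
      ∀ᶠ n in 𝓝 (π m), π (s n) = n := by
  obtain ⟨φ, χ, R, L, hφ, hχ, hRL, hm, hm', h⟩ := exists_charts_of_isSubmersion hπ m
  have hR : χ (π m) = R (φ m) := by
    have := (h (φ m) (φ.map_source hm)).2
    rwa [φ.left_inv hm] at this
  -- An affine slice through `φ m`: since `R L = 1` and `R (φ m) = χ (π m)`, applying `R` returns `χ
  -- n`.
  let s₀ : N → E := fun n => φ m + L (χ n - χ (π m))
  have hs₀ : ContMDiffAt 𝓘(ℝ, F) 𝓘(ℝ, E) ∞ s₀ (π m) := by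
    have h1 : ContDiff ℝ ∞ (fun a : F => φ m + L (a - χ (π m))) :=
      contDiff_const.add (L.contDiff.comp (contDiff_id.sub contDiff_const))
    exact h1.contMDiff.contMDiffAt.comp _ ((contMDiffOn_of_mem_maximalAtlas hχ).contMDiffAt
      (χ.open_source.mem_nhds hm'))
  have hs₀m : s₀ (π m) = φ m := by simp [s₀]
  refine ⟨fun n => φ.symm (s₀ n), ?_, (congrArg φ.symm hs₀m).trans (φ.left_inv hm), ?_⟩
  · refine ContMDiffAt.comp (π m) ?_ hs₀
    rw [hs₀m]
    exact (contMDiffOn_symm_of_mem_maximalAtlas hφ).contMDiffAt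
      (φ.open_target.mem_nhds (φ.map_source hm))
  · have h1 : ∀ᶠ n in 𝓝 (π m), s₀ n ∈ φ.target := by
      refine hs₀.continuousAt.preimage_mem_nhds ?_
      rw [hs₀m]
      exact φ.open_target.mem_nhds (φ.map_source hm)
    filter_upwards [h1, χ.open_source.mem_nhds hm'] with n hn hn'
    obtain ⟨h2, h3⟩ := h _ hn
    refine χ.injOn h2 hn' ?_
    rw [h3]
    simp [s₀, hRL, hR]

/-- The derivative of a local section through `m` is a right inverse. -/
theorem mfderiv_surjective_of_isSubmersion {π : M → N}
    (hπ : Manifold.IsSubmersion 𝓘(ℝ, E) 𝓘(ℝ, F) ∞ π) (m : M) :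
    Function.Surjective (mfderiv 𝓘(ℝ, E) 𝓘(ℝ, F) π m) := by
  obtain ⟨s, hs, hsm, hsec⟩ := exists_section_of_isSubmersion hπ m
  have hd : MDifferentiableAt 𝓘(ℝ, E) 𝓘(ℝ, F) π m := hπ.contMDiff.mdifferentiable (by simp) m
  have h1 := mfderiv_comp (π m) (hsm.symm ▸ hd) (hs.mdifferentiableAt (by simp))
  have h2 : π ∘ s =ᶠ[𝓝 (π m)] id := hsec
  rw [h2.mfderiv_eq, mfderiv_id] at h1
  have h3 : Function.Surjective (mfderiv 𝓘(ℝ, E) 𝓘(ℝ, F) π (s (π m))) := fun a =>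
    ⟨mfderiv 𝓘(ℝ, F) 𝓘(ℝ, E) s (π m) a, (DFunLike.congr_fun h1 a).symm⟩
  rwa [hsm] at h3

end Submersion

/-! ### Smoothness of the Hamiltonian of the horizontal distribution. -/

section HorizontalHamiltonian

variable {E F : Type*} [NormedAddCommGroup E] [NormedSpace ℝ E]
  [NormedAddCommGroup F] [NormedSpace ℝ F]
  {M : Type*} [TopologicalSpace M] [ChartedSpace E M] [IsManifold 𝓘(ℝ, E) ∞ M]
  {N : Type*} [TopologicalSpace N] [ChartedSpace F N]

/-- The metric at `x`, read in the trivialization of the tangent bundle at `x₀`. -/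
def metricInCoordinates (g : RiemannianMetricOn E M) (x₀ x : M) : E →L[ℝ] E →L[ℝ] ℝ :=
  ContinuousLinearMap.inCoordinates E (TangentSpace 𝓘(ℝ, E)) (E →L[ℝ] ℝ)
    (fun x : M => TangentSpace 𝓘(ℝ, E) x →L[ℝ] ℝ) x₀ x x₀ x (g.inner x)

theorem contMDiffAt_metricInCoordinates (g : RiemannianMetricOn E M) (x₀ : M) :
    ContMDiffAt 𝓘(ℝ, E) 𝓘(ℝ, E →L[ℝ] E →L[ℝ] ℝ) ∞ (metricInCoordinates g x₀) x₀ :=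
  ((contMDiffAt_hom_bundle _).1 (g.contMDiff x₀)).2

theorem metricInCoordinates_apply (g : RiemannianMetricOn E M) {x₀ x : M}
    (hx : x ∈ (chartAt E x₀).source) (v w : E) :
    metricInCoordinates g x₀ x v w =
      g.inner x ((trivializationAt E (TangentSpace 𝓘(ℝ, E)) x₀).symmL ℝ x v)
        ((trivializationAt E (TangentSpace 𝓘(ℝ, E)) x₀).symmL ℝ x w) := by
  have h := Bundle.Trivialization.continuousLinearMapAt_apply_of_mem (R := ℝ)
    (trivializationAt (E →L[ℝ] ℝ) (fun x : M => TangentSpace 𝓘(ℝ, E) x →L[ℝ] ℝ) x₀)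
    (b := x) (by rw [hom_trivializationAt_baseSet]; simpa using hx)
    (g.inner x ((trivializationAt E (TangentSpace 𝓘(ℝ, E)) x₀).symmL ℝ x v))
  rw [hom_trivializationAt_apply] at h
  refine (DFunLike.congr_fun h w).trans ?_
  simp [ContinuousLinearMap.inCoordinates]

/-- Two candidates differ by a horizontal vector orthogonal to all horizontal vectors, itself
included, so positivity forces equality. -/
theorem sharp_horizontal_eq {g : RiemannianMetricOn E M} {π : M → N} {m : M}
    {p : TangentSpace 𝓘(ℝ, E) m →L[ℝ] ℝ} {v : TangentSpace 𝓘(ℝ, E) m}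
    (hv : v ∈ horizontal (F := F) g π m)
    (h : ∀ w ∈ horizontal (F := F) g π m, p w = g.inner m v w) :
    sharp (horizontalDistribution (F := F) g π) (metricForm g) m p = v := by
  obtain ⟨h1, h2⟩ := Classical.epsilon_spec (p := fun v =>
    v ∈ horizontalDistribution (F := F) g π m ∧
      ∀ w ∈ horizontalDistribution (F := F) g π m, p w = metricForm g m v w) ⟨v, hv, h⟩
  have h3 : sharp (horizontalDistribution (F := F) g π) (metricForm g) m p - v ∈
      horizontal (F := F) g π m := Submodule.sub_mem _ h1 hv
  by_contra hne
  have h4 := g.pos m _ (sub_ne_zero.2 hne)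
  have h5 := (h2 _ h3).symm.trans (h _ h3)
  refine h4.ne' ?_
  rw [map_sub, g.symm m _ v, g.symm m _ (sharp _ _ m p)]
  exact sub_eq_zero.2 h5

variable [FiniteDimensional ℝ E] [FiniteDimensional ℝ F] [IsManifold 𝓘(ℝ, F) ∞ N]

omit [FiniteDimensional ℝ E] [FiniteDimensional ℝ F] in
theorem metricInCoordinates_pos (g : RiemannianMetricOn E M) {x₀ x : M}
    (hx : x ∈ (chartAt E x₀).source) (v : E) (hv : v ≠ 0) :
    0 < metricInCoordinates g x₀ x v v := by
  rw [metricInCoordinates_apply g hx]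
  refine g.pos x _ fun h => hv ?_
  have h1 := Bundle.Trivialization.continuousLinearMapAt_symmL (R := ℝ)
    (trivializationAt E (TangentSpace 𝓘(ℝ, E)) x₀) (b := x) (by simpa using hx) v
  rw [h, map_zero] at h1
  exact h1.symm

/-- The differential of `π` at `x`, read in the trivializations at `x₀` and `π x₀`. -/
def mfderivInCoordinates (π : M → N) (x₀ x : M) : E →L[ℝ] F :=
  inTangentCoordinates 𝓘(ℝ, E) 𝓘(ℝ, F) id π (mfderiv 𝓘(ℝ, E) 𝓘(ℝ, F) π) x₀ x

omit [FiniteDimensional ℝ E] [FiniteDimensional ℝ F] in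
theorem mfderivInCoordinates_eq_zero_iff {π : M → N} {x₀ x : M}
    (hy : π x ∈ (chartAt F (π x₀)).source) (v : E) :
    mfderivInCoordinates (F := F) π x₀ x v = 0 ↔ mfderiv 𝓘(ℝ, E) 𝓘(ℝ, F) π x
      ((trivializationAt E (TangentSpace 𝓘(ℝ, E)) x₀).symmL ℝ x v) = 0 := by
  have h1 := Bundle.Trivialization.symmL_continuousLinearMapAt (R := ℝ)
    (trivializationAt F (TangentSpace 𝓘(ℝ, F)) (π x₀)) (b := π x) (by simpa using hy)
    (mfderiv 𝓘(ℝ, E) 𝓘(ℝ, F) π x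
      ((trivializationAt E (TangentSpace 𝓘(ℝ, E)) x₀).symmL ℝ x v))
  have h2 : mfderivInCoordinates (F := F) π x₀ x v =
    (trivializationAt F (TangentSpace 𝓘(ℝ, F)) (π x₀)).continuousLinearMapAt ℝ (π x)
      (mfderiv 𝓘(ℝ, E) 𝓘(ℝ, F) π x
        ((trivializationAt E (TangentSpace 𝓘(ℝ, E)) x₀).symmL ℝ x v)) := rfl
  constructor
  · intro h
    rw [← h1, ← h2, h, map_zero]
  · intro h
    rw [h2, h, map_zero]

omit [FiniteDimensional ℝ E] [FiniteDimensional ℝ F] in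
theorem mfderivInCoordinates_surjective {π : M → N} {x₀ x : M}
    (hx : x ∈ (chartAt E x₀).source) (hy : π x ∈ (chartAt F (π x₀)).source)
    (hs : Function.Surjective (mfderiv 𝓘(ℝ, E) 𝓘(ℝ, F) π x)) :
    Function.Surjective (mfderivInCoordinates (E := E) (F := F) π x₀ x) := by
  intro a
  obtain ⟨v, hv⟩ := hs ((trivializationAt F (TangentSpace 𝓘(ℝ, F)) (π x₀)).symmL ℝ (π x) a)
  have h1 := Bundle.Trivialization.symmL_continuousLinearMapAt (R := ℝ)
    (trivializationAt E (TangentSpace 𝓘(ℝ, E)) x₀) (b := x) (by simpa using hx) v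
  have h2 := Bundle.Trivialization.continuousLinearMapAt_symmL (R := ℝ)
    (trivializationAt F (TangentSpace 𝓘(ℝ, F)) (π x₀)) (b := π x) (by simpa using hy) a
  rw [← hv, ← h1] at h2
  exact ⟨_, h2⟩

theorem horizontalSharp_inCoordinates_spec {g : RiemannianMetricOn E M} {π : M → N} {x₀ x : M}
    (hs : Function.Surjective (mfderiv 𝓘(ℝ, E) 𝓘(ℝ, F) π x))
    (hx : x ∈ (chartAt E x₀).source) (hy : π x ∈ (chartAt F (π x₀)).source)
    (p : TangentSpace 𝓘(ℝ, E) x →L[ℝ] ℝ) :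
    (trivializationAt E (TangentSpace 𝓘(ℝ, E)) x₀).symmL ℝ x
        (horizontalSharp (metricInCoordinates g x₀ x) (mfderivInCoordinates (F := F) π x₀ x)
          (covectorInCoordinates x₀ x p)) ∈ horizontal (F := F) g π x ∧
      ∀ w ∈ horizontal (F := F) g π x, p w = g.inner x
        ((trivializationAt E (TangentSpace 𝓘(ℝ, E)) x₀).symmL ℝ x
          (horizontalSharp (metricInCoordinates g x₀ x) (mfderivInCoordinates (F := F) π x₀ x)
            (covectorInCoordinates x₀ x p))) w := by
  have hT : ∀ w : TangentSpace 𝓘(ℝ, E) x, ∃ u : E,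
      (trivializationAt E (TangentSpace 𝓘(ℝ, E)) x₀).symmL ℝ x u = w := fun w =>
    ⟨_, Bundle.Trivialization.symmL_continuousLinearMapAt (R := ℝ)
      (trivializationAt E (TangentSpace 𝓘(ℝ, E)) x₀) (b := x) (by simpa using hx) w⟩
  have hpos := metricInCoordinates_pos g hx
  refine ⟨?_, ?_⟩
  · intro w hw
    obtain ⟨u, rfl⟩ := hT w
    rw [← metricInCoordinates_apply g hx]
    exact horizontalSharp_mem hpos _ ((mfderivInCoordinates_eq_zero_iff hy u).2 hw)
  · intro w hw
    obtain ⟨u, rfl⟩ := hT w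
    rw [← metricInCoordinates_apply g hx]
    refine horizontalSharp_spec hpos (fun v w => ?_) (mfderivInCoordinates_surjective hx hy hs)
      (covectorInCoordinates x₀ x p) (w := u) fun u' hu' => ?_
    · rw [metricInCoordinates_apply g hx, metricInCoordinates_apply g hx, g.symm]
    · rw [metricInCoordinates_apply g hx]
      exact hw _ ((mfderivInCoordinates_eq_zero_iff hy u').1 hu')

theorem sharp_horizontal_eq_horizontalSharp {g : RiemannianMetricOn E M} {π : M → N} {x₀ x : M}
    (hs : Function.Surjective (mfderiv 𝓘(ℝ, E) 𝓘(ℝ, F) π x))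
    (hx : x ∈ (chartAt E x₀).source) (hy : π x ∈ (chartAt F (π x₀)).source)
    (p : TangentSpace 𝓘(ℝ, E) x →L[ℝ] ℝ) :
    sharp (horizontalDistribution (F := F) g π) (metricForm g) x p =
      (trivializationAt E (TangentSpace 𝓘(ℝ, E)) x₀).symmL ℝ x
        (horizontalSharp (metricInCoordinates g x₀ x) (mfderivInCoordinates (F := F) π x₀ x)
          (covectorInCoordinates x₀ x p)) := by
  obtain ⟨h1, h2⟩ := horizontalSharp_inCoordinates_spec hs hx hy p (g := g)
  exact sharp_horizontal_eq h1 h2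

theorem sharp_horizontal_spec (g : RiemannianMetricOn E M) {π : M → N} {x : M}
    (hs : Function.Surjective (mfderiv 𝓘(ℝ, E) 𝓘(ℝ, F) π x))
    (p : TangentSpace 𝓘(ℝ, E) x →L[ℝ] ℝ) :
    sharp (horizontalDistribution (F := F) g π) (metricForm g) x p ∈ horizontal (F := F) g π x ∧
      ∀ w ∈ horizontal (F := F) g π x, p w =
        g.inner x (sharp (horizontalDistribution (F := F) g π) (metricForm g) x p) w := by
  rw [sharp_horizontal_eq_horizontalSharp hs (mem_chart_source E x) (mem_chart_source F (π x))]
  exact horizontalSharp_inCoordinates_spec hs (mem_chart_source E x) (mem_chart_source F (π x)) p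

/-- In the trivializations fixed at `z₀.proj` and its image, the metric, `dπ` and the covector
depend smoothly on `z`, and `horizontalSharp` is a smooth expression in them. The agreement with
`hamiltonian` holds only near `z₀`, over the chart domains. -/
theorem contMDiff_hamiltonian_horizontal (g : RiemannianMetricOn E M) {π : M → N}
    (hπ : ContMDiff 𝓘(ℝ, E) 𝓘(ℝ, F) ∞ π)
    (hs : ∀ x, Function.Surjective (mfderiv 𝓘(ℝ, E) 𝓘(ℝ, F) π x)) :
    ContMDiff (cotangentModel E) 𝓘(ℝ, ℝ) ∞
      (hamiltonian (horizontalDistribution (F := F) g π) (metricForm g)) := by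
  intro z₀
  set x₀ := z₀.proj with hx₀
  have hproj : ContMDiffAt (cotangentModel E) 𝓘(ℝ, E) ∞
    (fun z : CotangentBundle E M => z.proj) z₀ := Bundle.contMDiff_proj _ (n := ∞) z₀
  have hG : ContMDiffAt (cotangentModel E) 𝓘(ℝ, E →L[ℝ] E →L[ℝ] ℝ) ∞
      (fun z : CotangentBundle E M => metricInCoordinates g x₀ z.proj) z₀ :=
    (contMDiffAt_metricInCoordinates g x₀).comp z₀ hproj
  have hA : ContMDiffAt (cotangentModel E) 𝓘(ℝ, E →L[ℝ] F) ∞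
      (fun z : CotangentBundle E M => mfderivInCoordinates (F := F) π x₀ z.proj) z₀ :=
    ((hπ x₀).mfderiv_const (m := ∞) (by norm_cast)).comp z₀ hproj
  have hP : ContMDiffAt (cotangentModel E) 𝓘(ℝ, E →L[ℝ] ℝ) ∞
      (fun z : CotangentBundle E M => covectorInCoordinates x₀ z.proj z.snd) z₀ :=
    (contMDiffAt_cotangent_iff.1 (contMDiffAt_id (x := z₀))).2
  have hv := (contMDiffAt_horizontalSharp hG hA
    (metricInCoordinates_pos g (mem_chart_source E x₀))
    (mfderivInCoordinates_surjective (mem_chart_source E x₀) (mem_chart_source F _)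
      (hs x₀))).clm_apply hP
  have hc : ContDiff ℝ ∞ (fun r : ℝ => (1 / 2 : ℝ) * r) := contDiff_const.mul contDiff_id
  have hf := hc.contMDiff.contMDiffAt.comp z₀ ((hG.clm_apply hv).clm_apply hv)
  refine hf.congr_of_eventuallyEq ?_
  have h1 : ∀ᶠ z : CotangentBundle E M in 𝓝 z₀, z.proj ∈ (chartAt E x₀).source :=
    hproj.continuousAt.preimage_mem_nhds ((chartAt E x₀).open_source.mem_nhds
      (mem_chart_source E x₀))
  have h2 : ∀ᶠ z : CotangentBundle E M in 𝓝 z₀, π z.proj ∈ (chartAt F (π x₀)).source :=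
    (ContinuousAt.comp (f := fun z : CotangentBundle E M => z.proj) (hπ x₀).continuousAt
      hproj.continuousAt).preimage_mem_nhds ((chartAt F (π x₀)).open_source.mem_nhds
        (mem_chart_source F _))
  filter_upwards [h1, h2] with z hz1 hz2
  rw [hamiltonian, sharp_horizontal_eq_horizontalSharp (hs _) hz1 hz2]
  rw [metricForm, ← metricInCoordinates_apply g hz1]
  rfl

end HorizontalHamiltonian

/-! ### Comparison of the Hamiltonians of `M` and `M/K`. -/

section PushHamiltonian

variable {E EK EN : Type*} [NormedAddCommGroup E] [NormedSpace ℝ E] [FiniteDimensional ℝ E]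
  [NormedAddCommGroup EK] [NormedSpace ℝ EK]
  [NormedAddCommGroup EN] [NormedSpace ℝ EN] [FiniteDimensional ℝ EN]
  {H : Type*} [Group H]
  {M : Type*} [TopologicalSpace M] [ChartedSpace E M] [IsManifold 𝓘(ℝ, E) ∞ M]
  [MulAction Hᵐᵒᵖ M]
  {NK : Type*} [TopologicalSpace NK] [ChartedSpace EK NK] [IsManifold 𝓘(ℝ, EK) ∞ NK]
  {NH : Type*} [TopologicalSpace NH] [ChartedSpace EN NH] [IsManifold 𝓘(ℝ, EN) ∞ NH]
  {L L' : Subgroup H} {πK : M → NK} {πH : M → NH}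

omit [FiniteDimensional ℝ E] [FiniteDimensional ℝ EN] [IsManifold 𝓘(ℝ, E) ∞ M]
  [IsManifold 𝓘(ℝ, EK) ∞ NK] [IsManifold 𝓘(ℝ, EN) ∞ NH] in
-- With a local section `s` of `πK`, the points `s (πK x)` and `x` lie in one `L`-orbit, so `πH =
-- (πH ∘ s) ∘ πK` near `m`, and `dπH` factors through `dπK`.
theorem vertical_le_vertical (hL : L ≤ L') (hK : IsPrincipalBundle E EK L πK)
    (hH : IsPrincipalBundle E EN L' πH) (m : M) :
    vertical (E := E) (F := EK) πK m ≤ vertical (E := E) (F := EN) πH m := by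
  obtain ⟨s, hs, hsm, hsec⟩ := exists_section_of_isSubmersion hK.submersion m
  have hKd : MDifferentiableAt 𝓘(ℝ, E) 𝓘(ℝ, EK) πK m :=
    hK.submersion.contMDiff.mdifferentiable (by simp) m
  have hHs : MDifferentiableAt 𝓘(ℝ, EK) 𝓘(ℝ, EN) (πH ∘ s) (πK m) :=
    MDifferentiableAt.comp (πK m) (hH.submersion.contMDiff.mdifferentiable (by simp) _)
      (hs.mdifferentiableAt (by simp))
  have he : πH =ᶠ[𝓝 m] (πH ∘ s) ∘ πK := by
    filter_upwards [hKd.continuousAt.eventually hsec] with x hx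
    obtain ⟨k, hk, hxk⟩ := (hK.fiber_iff _ _).1 hx
    exact ((hH.fiber_iff _ _).2 ⟨k, hL hk, hxk⟩).symm
  intro v hv
  have hv' : mfderiv 𝓘(ℝ, E) 𝓘(ℝ, EK) πK m v = 0 := hv
  have h1 : mfderiv 𝓘(ℝ, E) 𝓘(ℝ, EN) πH m v =
      mfderiv 𝓘(ℝ, EK) 𝓘(ℝ, EN) (πH ∘ s) (πK m) (mfderiv 𝓘(ℝ, E) 𝓘(ℝ, EK) πK m v) := by
    rw [he.mfderiv_eq, mfderiv_comp m hHs hKd]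
    rfl
  rw [hv', map_zero] at h1
  exact h1

omit [FiniteDimensional ℝ E] [FiniteDimensional ℝ EN]
  [IsManifold 𝓘(ℝ, EK) ∞ NK] [IsManifold 𝓘(ℝ, EN) ∞ NH] in
theorem horizontal_le_horizontal (hL : L ≤ L') (hK : IsPrincipalBundle E EK L πK)
    (hH : IsPrincipalBundle E EN L' πH) (g : RiemannianMetricOn E M) (m : M) :
    horizontal (F := EN) g πH m ≤ horizontal (F := EK) g πK m :=
  fun _ hv w hw => hv w (vertical_le_vertical hL hK hH m hw)

omit [FiniteDimensional ℝ EN] [IsManifold 𝓘(ℝ, EK) ∞ NK] [IsManifold 𝓘(ℝ, EN) ∞ NH] in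
/-- The image of an invariant horizontal distribution can be computed at any point of the fibre. -/
theorem mem_pushDistribution_iff (hL : L ≤ L') (hK : IsPrincipalBundle E EK L πK)
    (hH : IsPrincipalBundle E EN L' πH)
    (hact : ∀ h : H, ContMDiff 𝓘(ℝ, E) 𝓘(ℝ, E) ∞ (fun x : M => x <• h))
    {g : RiemannianMetricOn E M} (hg : IsInvariant H g) (m : M)
    (a : TangentSpace 𝓘(ℝ, EK) (πK m)) :
    a ∈ pushDistribution πK (horizontalDistribution (F := EN) g πH) (πK m) ↔
      ∃ v ∈ horizontal (F := EN) g πH m, mfderiv 𝓘(ℝ, E) 𝓘(ℝ, EK) πK m v = a := by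
  constructor
  · rintro ⟨m', v', hv', h⟩
    -- Translation by `k ∈ L ≤ L'` carries `m'` to `m`, keeps `πH`-horizontal vectors horizontal,
    -- and does not change their image under `dπK`.
    obtain ⟨k, hk, rfl⟩ := (hK.fiber_iff m' m).1 (Bundle.TotalSpace.ext_iff.1 h).1
    refine ⟨_, translate_mem_horizontal hH hact hg (hL hk) hv', ?_⟩
    have h2 := (tangentMap_translate hK hact hk m' v').trans h
    exact eq_of_heq (Bundle.TotalSpace.ext_iff.1 h2).2
  · rintro ⟨v, hv, rfl⟩
    exact ⟨m, v, hv, rfl⟩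

omit [IsManifold 𝓘(ℝ, EK) ∞ NK] in
/-- The sub-Riemannian Hamiltonian of the quotient, pulled back along `dπ*`, is that of `M`. -/
theorem hamiltonian_push_eq (hL : L ≤ L') (hK : IsPrincipalBundle E EK L πK)
    (hH : IsPrincipalBundle E EN L' πH)
    (hact : ∀ h : H, ContMDiff 𝓘(ℝ, E) 𝓘(ℝ, E) ∞ (fun x : M => x <• h))
    {g : RiemannianMetricOn E M} (hg : IsInvariant H g) (m : M)
    (ν : TangentSpace 𝓘(ℝ, EK) (πK m) →L[ℝ] ℝ) :
    hamiltonian (pushDistribution πK (horizontalDistribution (F := EN) g πH))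
      (quotientMetric g πK) (⟨πK m, ν⟩ : CotangentBundle EK NK) =
    hamiltonian (horizontalDistribution (F := EN) g πH) (metricForm g)
      (pullbackCovector πK m ν) := by
  have hle := horizontal_le_horizontal hL hK hH g m
  have hq : ∀ u ∈ horizontal (F := EN) g πH m, ∀ w ∈ horizontal (F := EN) g πH m,
      quotientMetric g πK (πK m) (mfderiv 𝓘(ℝ, E) 𝓘(ℝ, EK) πK m u)
        (mfderiv 𝓘(ℝ, E) 𝓘(ℝ, EK) πK m w) = g.inner m u w := fun u hu w hw =>
    quotientMetric_apply hK hact hg m (hle hu) (hle hw)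
  set p : TangentSpace 𝓘(ℝ, E) m →L[ℝ] ℝ := ν.comp (mfderiv 𝓘(ℝ, E) 𝓘(ℝ, EK) πK m) with hp
  obtain ⟨hv, hv'⟩ := sharp_horizontal_spec (F := EN) g
    (mfderiv_surjective_of_isSubmersion hH.submersion m) p
  set v := sharp (horizontalDistribution (F := EN) g πH) (metricForm g) m p with hvdef
  -- `dπK v` witnesses that a sharp vector of `ν` exists. The chosen one is `dπK u` with `u`
  -- horizontal, and the isometry `hq` makes `u` a sharp vector of `p`, hence equal to `v`.
  obtain ⟨h1, h2⟩ := Classical.epsilon_spec (p := fun a : TangentSpace 𝓘(ℝ, EK) (πK m) =>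
    a ∈ pushDistribution πK (horizontalDistribution (F := EN) g πH) (πK m) ∧
      ∀ b ∈ pushDistribution πK (horizontalDistribution (F := EN) g πH) (πK m),
        ν b = quotientMetric g πK (πK m) a b)
    ⟨mfderiv 𝓘(ℝ, E) 𝓘(ℝ, EK) πK m v,
      (mem_pushDistribution_iff hL hK hH hact hg m _).2 ⟨v, hv, rfl⟩, fun b hb => by
        obtain ⟨w, hw, rfl⟩ := (mem_pushDistribution_iff hL hK hH hact hg m _).1 hb
        rw [hq v hv w hw]
        exact hv' w hw⟩
  change (sharp (pushDistribution πK (horizontalDistribution (F := EN) g πH))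
      (quotientMetric g πK) (πK m) ν) ∈ _ at h1
  change ∀ b ∈ _, ν b = quotientMetric g πK (πK m)
    (sharp (pushDistribution πK (horizontalDistribution (F := EN) g πH))
      (quotientMetric g πK) (πK m) ν) b at h2
  obtain ⟨u, hu, hu'⟩ := (mem_pushDistribution_iff hL hK hH hact hg m _).1 h1
  rw [← hu'] at h2
  have huv : v = u := sharp_horizontal_eq hu fun w hw =>
    (h2 _ ((mem_pushDistribution_iff hL hK hH hact hg m _).2 ⟨w, hw, rfl⟩)).trans (hq u hu w hw)
  change (1 / 2 : ℝ) * quotientMetric g πK (πK m) (sharp _ _ (πK m) ν) (sharp _ _ (πK m) ν) =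
    (1 / 2 : ℝ) * g.inner m v v
  rw [← hu', hq u hu u hu, huv]

end PushHamiltonian

/-! ### Smoothness of the Hamiltonian of the base. -/

section Descent

variable {E F : Type*} [NormedAddCommGroup E] [NormedSpace ℝ E]
  [NormedAddCommGroup F] [NormedSpace ℝ F]
  {M : Type*} [TopologicalSpace M] [ChartedSpace E M] [IsManifold 𝓘(ℝ, E) ∞ M]
  {N : Type*} [TopologicalSpace N] [ChartedSpace F N] [IsManifold 𝓘(ℝ, F) ∞ N]

/-- A function on `T*N` is smooth if its pull-back to covectors of `M` along a surjective submersion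
extends smoothly to `T*M`. -/
theorem contMDiff_of_pullbackCovector {π : M → N}
    (hπ : Manifold.IsSubmersion 𝓘(ℝ, E) 𝓘(ℝ, F) ∞ π) (hsurj : Function.Surjective π)
    {f : CotangentBundle E M → ℝ} {h : CotangentBundle F N → ℝ}
    (hf : ContMDiff (cotangentModel E) 𝓘(ℝ, ℝ) ∞ f)
    (hfh : ∀ (m : M) (ν : TangentSpace 𝓘(ℝ, F) (π m) →L[ℝ] ℝ),
      h ⟨π m, ν⟩ = f (pullbackCovector π m ν)) :
    ContMDiff (cotangentModel F) 𝓘(ℝ, ℝ) ∞ h := by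
  intro w₀
  obtain ⟨m, hm⟩ := hsurj w₀.proj
  obtain ⟨s, hs, hsm, hsec⟩ := exists_section_of_isSubmersion hπ m
  rw [hm] at hs hsm hsec
  have hproj : ContMDiffAt (cotangentModel F) 𝓘(ℝ, F) ∞
    (fun w : CotangentBundle F N => w.proj) w₀ := Bundle.contMDiff_proj _ (n := ∞) w₀
  have hbase : ContMDiffAt (cotangentModel F) 𝓘(ℝ, E) ∞
    (fun w : CotangentBundle F N => s w.proj) w₀ := ContMDiffAt.comp w₀ hs hproj
  -- `w.snd` can be reread as a covector at `π (s w.proj)` because all tangent spaces are the model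
  -- space; near `w₀` the base point is unchanged, and `h w` becomes `f` of a pull-back at `s
  -- w.proj`.
  have hid : ∀ᶠ w : CotangentBundle F N in 𝓝 w₀,
      (⟨π (s w.proj), w.snd⟩ : CotangentBundle F N) = w := by
    filter_upwards [hproj.continuousAt.eventually hsec] with w hw
    obtain ⟨n, ν⟩ := w
    change π (s n) = n at hw
    change (⟨π (s n), ν⟩ : CotangentBundle F N) = ⟨n, ν⟩
    have key : ∀ n' : N, n' = n → (⟨n', ν⟩ : CotangentBundle F N) = ⟨n, ν⟩ := by
      rintro _ rfl
      rfl
    exact key _ hw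
  have h1 := contMDiffAt_covector_comp_mfderiv (φ := π) (f := fun w : CotangentBundle F N => s w.proj)
    (w := fun w : CotangentBundle F N => w.snd) (q₀ := w₀) (hπ.contMDiff _) hbase
    (contMDiffAt_id.congr_of_eventuallyEq hid)
  refine ((hf _).comp w₀ h1).congr_of_eventuallyEq ?_
  filter_upwards [hid] with w hw
  exact (congrArg h hw).symm.trans (hfh (s w.proj) w.snd)

end Descent

/-! ### Coisotropic reduction in submersion charts. -/

section Reduction

variable {E F : Type*} [NormedAddCommGroup E] [NormedSpace ℝ E] [FiniteDimensional ℝ E]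
  [NormedAddCommGroup F] [NormedSpace ℝ F] [FiniteDimensional ℝ F]

/-- Hamilton's equations on the covectors that vanish on `ker R`. -/
def coisotropicVec (f : E × (E →L[ℝ] ℝ) → ℝ) (R : E →L[ℝ] F) (L : F →L[ℝ] E)
    (c : E × (F →L[ℝ] ℝ)) : E × (F →L[ℝ] ℝ) :=
  ((hamVec f (c.1, c.2.comp R)).1, (hamVec f (c.1, c.2.comp R)).2.comp L)

/-- The inclusion `(q, p) ↦ (q, p ∘ R)`. -/
def coisotropicIncl (R : E →L[ℝ] F) : (E × (F →L[ℝ] ℝ)) →L[ℝ] (E × (E →L[ℝ] ℝ)) :=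
  (ContinuousLinearMap.fst ℝ E (F →L[ℝ] ℝ)).prod
    ((transposeL E F R).comp (ContinuousLinearMap.snd ℝ E (F →L[ℝ] ℝ)))

/-- The projection `(q, p) ↦ (R q, p)`. -/
def coisotropicProj (R : E →L[ℝ] F) : (E × (F →L[ℝ] ℝ)) →L[ℝ] (F × (F →L[ℝ] ℝ)) :=
  (R.comp (ContinuousLinearMap.fst ℝ E (F →L[ℝ] ℝ))).prod
    (ContinuousLinearMap.snd ℝ E (F →L[ℝ] ℝ))

omit [FiniteDimensional ℝ E] [FiniteDimensional ℝ F] in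
@[simp] theorem coisotropicProj_apply (R : E →L[ℝ] F) (c : E × (F →L[ℝ] ℝ)) :
    coisotropicProj R c = (R c.1, c.2) := rfl

omit [FiniteDimensional ℝ F] in
theorem contDiffAt_coisotropicVec {f : E × (E →L[ℝ] ℝ) → ℝ} {R : E →L[ℝ] F} {L : F →L[ℝ] E}
    {c : E × (F →L[ℝ] ℝ)} (hf : ContDiffAt ℝ ∞ f (coisotropicIncl R c)) :
    ContDiffAt ℝ ∞ (coisotropicVec f R L) c := by
  have h1 : ContDiffAt ℝ ∞ (fun c => hamVec f (coisotropicIncl R c)) c :=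
    (contDiffAt_hamVec hf).comp c (coisotropicIncl R).contDiff.contDiffAt
  exact h1.fst.prodMk (h1.snd.clm_comp contDiffAt_const)

section

variable {f : E × (E →L[ℝ] ℝ) → ℝ} {h : F × (F →L[ℝ] ℝ) → ℝ} {R : E →L[ℝ] F} {L : F →L[ℝ] E}
  {c : E × (F →L[ℝ] ℝ)}

omit [FiniteDimensional ℝ E] [FiniteDimensional ℝ F] in
-- The chain rule for `f (q, p ∘ R) = h (R q, p)`. Only directions tangent to the coisotropic
-- subspace occur; `(v, 0)` and `(0, p)` give the two halves of Hamilton's equations.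
theorem fderiv_coisotropicIncl (hf : DifferentiableAt ℝ f (coisotropicIncl R c))
    (hh : DifferentiableAt ℝ h (coisotropicProj R c))
    (hfh : ∀ᶠ c' in 𝓝 c, f (coisotropicIncl R c') = h (coisotropicProj R c'))
    (u : E × (F →L[ℝ] ℝ)) :
    fderiv ℝ f (coisotropicIncl R c) (u.1, u.2.comp R) =
      fderiv ℝ h (coisotropicProj R c) (R u.1, u.2) := by
  have h1 := hf.hasFDerivAt.comp c (coisotropicIncl R).hasFDerivAt
  have h2 := hh.hasFDerivAt.comp c (coisotropicProj R).hasFDerivAt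
  have h3 : f ∘ coisotropicIncl R =ᶠ[𝓝 c] h ∘ coisotropicProj R := hfh
  exact DFunLike.congr_fun (h1.unique (h2.congr_of_eventuallyEq h3)) u

omit [FiniteDimensional ℝ F] in
/-- Covectors vanishing on `ker R` are preserved by a Hamiltonian flow that descends along `R`. -/
theorem coisotropicIncl_coisotropicVec (hRL : ∀ a, R (L a) = a)
    (hf : DifferentiableAt ℝ f (coisotropicIncl R c))
    (hh : DifferentiableAt ℝ h (coisotropicProj R c))
    (hfh : ∀ᶠ c' in 𝓝 c, f (coisotropicIncl R c') = h (coisotropicProj R c')) :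
    coisotropicIncl R (coisotropicVec f R L c) = hamVec f (coisotropicIncl R c) := by
  refine Prod.ext rfl ?_
  ext v
  -- `v` and `L (R v)` have the same image under `R`, hence the same `q`-derivative of `f`; so the
  -- momentum component factors through `R`.
  have h1 := fderiv_coisotropicIncl hf hh hfh (v, 0)
  have h2 := fderiv_coisotropicIncl hf hh hfh (L (R v), 0)
  simp only [ContinuousLinearMap.zero_comp, hRL] at h1 h2
  change (hamVec f (coisotropicIncl R c)).2 (L (R v)) = (hamVec f (coisotropicIncl R c)).2 v
  rw [hamVec_snd_apply, hamVec_snd_apply, h1, h2]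

/-- Directions `(0, p)` give `R q' = ∂h/∂p`; directions `(L a, 0)` give `p' = -∂h/∂q`. -/
theorem coisotropicProj_coisotropicVec (hRL : ∀ a, R (L a) = a)
    (hf : DifferentiableAt ℝ f (coisotropicIncl R c))
    (hh : DifferentiableAt ℝ h (coisotropicProj R c))
    (hfh : ∀ᶠ c' in 𝓝 c, f (coisotropicIncl R c') = h (coisotropicProj R c')) :
    coisotropicProj R (coisotropicVec f R L c) = hamVec h (coisotropicProj R c) := by
  refine Prod.ext ((SeparatingDual.eq_iff_forall_dual_eq (R := ℝ)).2 fun p => ?_) ?_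
  · have h1 := fderiv_coisotropicIncl hf hh hfh (0, p)
    rw [map_zero] at h1
    rw [apply_hamVec_fst, ← h1]
    exact apply_hamVec_fst f (coisotropicIncl R c) (p.comp R)
  · ext a
    have h1 := fderiv_coisotropicIncl hf hh hfh (L a, 0)
    simp only [ContinuousLinearMap.zero_comp, hRL] at h1
    change (hamVec f (coisotropicIncl R c)).2 (L a) = _
    rw [hamVec_snd_apply, hamVec_snd_apply, h1]

end

variable {M : Type*} [TopologicalSpace M] [ChartedSpace E M] [IsManifold 𝓘(ℝ, E) ∞ M]
  {N : Type*} [TopologicalSpace N] [ChartedSpace F N] [IsManifold 𝓘(ℝ, F) ∞ N]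

/-- `z` is the pull-back of the covector `w` along `π`. -/
def IsPullback (π : M → N) (z : CotangentBundle E M) (w : CotangentBundle F N) : Prop :=
  ∃ (m : M) (ν : TangentSpace 𝓘(ℝ, F) (π m) →L[ℝ] ℝ), z = pullbackCovector π m ν ∧ w = ⟨π m, ν⟩

omit [FiniteDimensional ℝ E] [FiniteDimensional ℝ F]
  [IsManifold 𝓘(ℝ, E) ∞ M] [IsManifold 𝓘(ℝ, F) ∞ N] in
-- Differentiating `χ ∘ π = R ∘ φ` gives `p ∘ R ∘ dφ = (p ∘ dχ) ∘ dπ`, so `ν = p ∘ dχ`: in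
-- coordinates, pulling back is `p ↦ p ∘ R`.
theorem cotangentLift_eq_pullback {π : M → N} {φ : OpenPartialHomeomorph M E}
    {χ : OpenPartialHomeomorph N F} {R : E →L[ℝ] F}
    (hπ : MDifferentiable 𝓘(ℝ, E) 𝓘(ℝ, F) π)
    (hφ : φ ∈ IsManifold.maximalAtlas 𝓘(ℝ, E) ∞ M)
    (hχ : χ ∈ IsManifold.maximalAtlas 𝓘(ℝ, F) ∞ N)
    (h : ∀ q ∈ φ.target, π (φ.symm q) ∈ χ.source ∧ χ (π (φ.symm q)) = R q)
    {q : E} (hq : q ∈ φ.target) (p : F →L[ℝ] ℝ) :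
    ∃ ν : TangentSpace 𝓘(ℝ, F) (π (φ.symm q)) →L[ℝ] ℝ,
      cotangentLift φ (q, p.comp R) = pullbackCovector π (φ.symm q) ν ∧
      cotangentLift χ (R q, p) = ⟨π (φ.symm q), ν⟩ := by
  set x := φ.symm q with hx
  have hxs : x ∈ φ.source := φ.map_target hq
  have hχd : MDifferentiableAt 𝓘(ℝ, F) 𝓘(ℝ, F) χ (π x) :=
    ((contMDiffOn_of_mem_maximalAtlas hχ).contMDiffAt
      (χ.open_source.mem_nhds (h q hq).1)).mdifferentiableAt (by simp)
  have hφd : MDifferentiableAt 𝓘(ℝ, E) 𝓘(ℝ, E) φ x :=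
    ((contMDiffOn_of_mem_maximalAtlas hφ).contMDiffAt
      (φ.open_source.mem_nhds hxs)).mdifferentiableAt (by simp)
  refine ⟨(p : TangentSpace 𝓘(ℝ, F) (χ (π x)) →L[ℝ] ℝ).comp
    (mfderiv 𝓘(ℝ, F) 𝓘(ℝ, F) χ (π x)), ?_, ?_⟩
  · have h1 : χ ∘ π =ᶠ[𝓝 x] R ∘ φ := by
      filter_upwards [φ.open_source.mem_nhds hxs] with y hy
      have := (h (φ y) (φ.map_source hy)).2
      rwa [φ.left_inv hy] at this
    have h2 := mfderiv_comp x hχd (hπ x)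
    have h3 := mfderiv_comp (I' := 𝓘(ℝ, E)) x R.differentiableAt.mdifferentiableAt hφd
    rw [h1.mfderiv_eq, h3, mfderiv_eq_fderiv, R.fderiv] at h2
    have h4 := congrArg (fun A => p.comp A) h2
    exact congrArg (fun A => (⟨x, A⟩ : CotangentBundle E M)) h4
  · have h1 : χ.symm (R q) = π x := by
      rw [← (h q hq).2, χ.left_inv (h q hq).1]
    have key : ∀ n : N, n = π x → (⟨n, (p : TangentSpace 𝓘(ℝ, F) (χ n) →L[ℝ] ℝ).comp
        (mfderiv 𝓘(ℝ, F) 𝓘(ℝ, F) χ n)⟩ : CotangentBundle F N) = ⟨π x, (p : TangentSpace 𝓘(ℝ, F)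
        (χ (π x)) →L[ℝ] ℝ).comp (mfderiv 𝓘(ℝ, F) 𝓘(ℝ, F) χ (π x))⟩ := by
      rintro _ rfl
      rfl
    exact key _ h1

omit [FiniteDimensional ℝ F] [IsManifold 𝓘(ℝ, F) ∞ N] in
-- The coordinates of `ν` are `ν ∘ d(χ⁻¹)`, since `d(χ⁻¹) ∘ dχ = 1`.
theorem exists_cotangentLift_eq {χ : OpenPartialHomeomorph N F}
    (hχ : χ ∈ IsManifold.maximalAtlas 𝓘(ℝ, F) ∞ N) {n : N} (hn : n ∈ χ.source)
    (ν : TangentSpace 𝓘(ℝ, F) n →L[ℝ] ℝ) :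
    ∃ p : F →L[ℝ] ℝ, cotangentLift χ (χ n, p) = ⟨n, ν⟩ := by
  have hχd : MDifferentiableAt 𝓘(ℝ, F) 𝓘(ℝ, F) χ n :=
    ((contMDiffOn_of_mem_maximalAtlas hχ).contMDiffAt
      (χ.open_source.mem_nhds hn)).mdifferentiableAt (by simp)
  have hχd' : MDifferentiableAt 𝓘(ℝ, F) 𝓘(ℝ, F) χ.symm (χ n) :=
    ((contMDiffOn_symm_of_mem_maximalAtlas hχ).contMDiffAt
      (χ.open_target.mem_nhds (χ.map_source hn))).mdifferentiableAt (by simp)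
  let B : F →L[ℝ] F := mfderiv 𝓘(ℝ, F) 𝓘(ℝ, F) χ.symm (χ n)
  let A : F →L[ℝ] F := mfderiv 𝓘(ℝ, F) 𝓘(ℝ, F) χ n
  have h1 := mfderiv_comp n hχd' hχd
  have h2 : χ.symm ∘ χ =ᶠ[𝓝 n] id := by
    filter_upwards [χ.open_source.mem_nhds hn] with y hy
    exact χ.left_inv hy
  rw [h2.mfderiv_eq, mfderiv_id] at h1
  refine ⟨(ν : F →L[ℝ] ℝ).comp B, ?_⟩
  have h3 : ((ν : F →L[ℝ] ℝ).comp B).comp A = ν := by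
    ext v
    have := congrArg (fun A : F →L[ℝ] F => (ν : F →L[ℝ] ℝ) (A v)) h1
    exact this.symm
  have h4 : χ.symm (χ n) = n := χ.left_inv hn
  have key : ∀ n' : N, n' = n → (⟨n', (((ν : F →L[ℝ] ℝ).comp B) : TangentSpace 𝓘(ℝ, F) (χ n')
      →L[ℝ] ℝ).comp (mfderiv 𝓘(ℝ, F) 𝓘(ℝ, F) χ n')⟩ : CotangentBundle F N) = ⟨n, ν⟩ := by
    rintro _ rfl
    exact congrArg (fun A => (⟨_, A⟩ : CotangentBundle F N)) h3
  exact key _ h4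

end Reduction

/-! ### Integral curves of related Hamiltonians. -/

section LocalCurves

variable {E F : Type*} [NormedAddCommGroup E] [NormedSpace ℝ E]
  [NormedAddCommGroup F] [NormedSpace ℝ F]
  {M : Type*} [TopologicalSpace M] [ChartedSpace E M] [IsManifold 𝓘(ℝ, E) ∞ M]
  {N : Type*} [TopologicalSpace N] [ChartedSpace F N] [IsManifold 𝓘(ℝ, F) ∞ N]
  {π : M → N} {f : CotangentBundle E M → ℝ} {h : CotangentBundle F N → ℝ}

omit [IsManifold 𝓘(ℝ, E) ∞ M] [IsManifold 𝓘(ℝ, F) ∞ N] in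
-- Reading covectors as forms on the model spaces separates the equation of footpoints from that of
-- covectors.
theorem isPullback_iff {z : CotangentBundle E M} {w : CotangentBundle F N} :
    IsPullback π z w ↔ π z.proj = w.proj ∧
      (z.snd : E →L[ℝ] ℝ) = (w.snd : F →L[ℝ] ℝ).comp (mfderiv 𝓘(ℝ, E) 𝓘(ℝ, F) π z.proj) := by
  constructor
  · rintro ⟨m, ν, rfl, rfl⟩
    exact ⟨rfl, rfl⟩
  · obtain ⟨x, p⟩ := z
    obtain ⟨n, ν⟩ := w
    rintro ⟨h1, h2⟩
    obtain rfl : π x = n := h1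
    exact ⟨x, ν, congrArg (fun A => (⟨x, A⟩ : CotangentBundle E M)) h2, rfl⟩

/-- Being a pull-back passes to limits. -/
theorem isPullback_of_frequently [T2Space N] (hπ : ContMDiff 𝓘(ℝ, E) 𝓘(ℝ, F) ∞ π)
    {Z : ℝ → CotangentBundle E M} {W : ℝ → CotangentBundle F N} {t : ℝ}
    (hZ : ContinuousAt Z t) (hW : ContinuousAt W t)
    (hr : ∃ᶠ s in 𝓝 t, IsPullback π (Z s) (W s)) : IsPullback π (Z t) (W t) := by
  set x₀ := (Z t).proj with hx₀
  have hZp : ContinuousAt (fun s => (Z s).proj) t :=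
    (Bundle.contMDiff_proj (IB := 𝓘(ℝ, E)) (F := E →L[ℝ] ℝ)
      (fun x : M => TangentSpace 𝓘(ℝ, E) x →L[ℝ] ℝ) (n := ∞)).continuous.continuousAt.comp hZ
  have hWp : ContinuousAt (fun s => (W s).proj) t :=
    (Bundle.contMDiff_proj (IB := 𝓘(ℝ, F)) (F := F →L[ℝ] ℝ)
      (fun x : N => TangentSpace 𝓘(ℝ, F) x →L[ℝ] ℝ) (n := ∞)).continuous.continuousAt.comp hW
  have hπZ : ContinuousAt (fun s => π (Z s).proj) t :=
    ContinuousAt.comp (g := π) hπ.continuous.continuousAt hZp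
  have hbase : π x₀ = (W t).proj := by
    by_contra hne
    have h1 : ∀ᶠ s in 𝓝 t, π (Z s).proj ≠ (W s).proj :=
      (hπZ.prodMk hWp).eventually (isClosed_diagonal.isOpen_compl.eventually_mem hne)
    obtain ⟨s, hs, hs'⟩ := (hr.and_eventually h1).exists
    exact hs' (isPullback_iff.1 hs).1
  obtain ⟨ν, hν⟩ : ∃ ν : TangentSpace 𝓘(ℝ, F) (π x₀) →L[ℝ] ℝ, W t = ⟨π x₀, ν⟩ := by
    have key : ∀ w : CotangentBundle F N, π x₀ = w.proj →
        ∃ ν : TangentSpace 𝓘(ℝ, F) (π x₀) →L[ℝ] ℝ, w = ⟨π x₀, ν⟩ := by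
      rintro ⟨n, ν⟩ h
      obtain rfl : π x₀ = n := h
      exact ⟨ν, rfl⟩
    exact key _ hbase
  -- Covectors over moving points are compared in trivializations fixed at `x₀` and `π x₀`. There
  -- the relation reads `a = b ∘ B`, an equation between continuous functions.
  let a : ℝ → E →L[ℝ] ℝ := fun s => covectorInCoordinates x₀ (Z s).proj (Z s).snd
  let b : ℝ → F →L[ℝ] ℝ := fun s => covectorInCoordinates (π x₀) (W s).proj (W s).snd
  let B : ℝ → E →L[ℝ] F := fun s => mfderivInCoordinates (F := F) π x₀ (Z s).proj
  have ha : ContinuousAt a t :=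
    (contMDiffAt_cotangent_iff.1 (contMDiffAt_id (x := Z t) (n := ∞))).2.continuousAt.comp hZ
  have hb : ContinuousAt b t := by
    have h1 := (contMDiffAt_cotangent_iff.1
      (contMDiffAt_id (x := W t) (n := ∞))).2.continuousAt.comp hW
    simp only [id, ← hbase] at h1
    exact h1
  have hB : ContinuousAt B t :=
    ContinuousAt.comp (g := mfderivInCoordinates (E := E) (F := F) π x₀)
      ((hπ x₀).mfderiv_const (m := ∞) (by norm_cast)).continuousAt hZp
  have hy : ∀ᶠ s in 𝓝 t, π (Z s).proj ∈ (chartAt F (π x₀)).source :=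
    hπZ.preimage_mem_nhds ((chartAt F (π x₀)).open_source.mem_nhds (mem_chart_source F _))
  have hab : a t = (b t).comp (B t) := by
    refine tendsto_nhds_unique_of_frequently_eq ha (hb.clm_comp hB)
      ((hr.and_eventually hy).mono ?_)
    rintro s ⟨⟨m, ν', hz, hw⟩, hs⟩
    simp only [a, b, B]
    rw [hz] at hs ⊢
    rw [hw]
    exact covectorInCoordinates_comp hs _ _
  refine ⟨x₀, ν, ?_, hν⟩
  have h1 : b t = covectorInCoordinates (π x₀) (π x₀) ν := by
    simp only [b]
    rw [hν]
  have h2 : a t = covectorInCoordinates x₀ x₀ (ν.comp (mfderiv 𝓘(ℝ, E) 𝓘(ℝ, F) π x₀)) := by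
    rw [hab, h1]
    exact (covectorInCoordinates_comp (mem_chart_source F _) _ _).symm
  have h3 := covectorInCoordinates_injective (mem_chart_source E x₀) h2
  exact congrArg (fun A => (⟨x₀, A⟩ : CotangentBundle E M)) h3

variable [FiniteDimensional ℝ E] [FiniteDimensional ℝ F]

/-- Picard–Lindelöf for the single field `coisotropicVec` on `E × F*` supplies a curve `α`. Its
images under `coisotropicIncl` and `coisotropicProj` solve Hamilton's equations for `f` and `h`, and
they are related because they come from the same `α`. -/
theorem exists_local_integralCurves
    (hπ : Manifold.IsSubmersion 𝓘(ℝ, E) 𝓘(ℝ, F) ∞ π)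
    (hf : ContMDiff (cotangentModel E) 𝓘(ℝ, ℝ) ∞ f)
    (hh : ContMDiff (cotangentModel F) 𝓘(ℝ, ℝ) ∞ h)
    (hfh : ∀ (m : M) (ν : TangentSpace 𝓘(ℝ, F) (π m) →L[ℝ] ℝ),
      h ⟨π m, ν⟩ = f (pullbackCovector π m ν))
    (m : M) (ν : TangentSpace 𝓘(ℝ, F) (π m) →L[ℝ] ℝ) (t₀ : ℝ) :
    ∃ (Z : ℝ → CotangentBundle E M) (W : ℝ → CotangentBundle F N),
      Z t₀ = pullbackCovector π m ν ∧ W t₀ = ⟨π m, ν⟩ ∧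
      IsMIntegralCurveAt (I := cotangentModel E) Z (hamiltonianVectorField f) t₀ ∧
      IsMIntegralCurveAt (I := cotangentModel F) W (hamiltonianVectorField h) t₀ ∧
      ∀ᶠ t in 𝓝 t₀, IsPullback π (Z t) (W t) := by
  obtain ⟨φ, χ, R, L, hφ, hχ, hRL, hm, hm', hc⟩ := exists_charts_of_isSubmersion hπ m
  have hπd : MDifferentiable 𝓘(ℝ, E) 𝓘(ℝ, F) π := hπ.contMDiff.mdifferentiable (by simp)
  have hΛ := isCanonicalOn_cotangentLift hφ
  have hΘ := isCanonicalOn_cotangentLift hχ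
  have hRm : χ (π m) = R (φ m) := by
    have := (hc (φ m) (φ.map_source hm)).2
    rwa [φ.left_inv hm] at this
  obtain ⟨p₀, hp₀⟩ := exists_cotangentLift_eq hχ hm' ν
  have hmemΛ : ∀ c : E × (F →L[ℝ] ℝ), c.1 ∈ φ.target →
      coisotropicIncl R c ∈ φ.target ×ˢ (univ : Set (E →L[ℝ] ℝ)) := fun c hc => ⟨hc, mem_univ _⟩
  have hmemΘ : ∀ c : E × (F →L[ℝ] ℝ), c.1 ∈ φ.target →
      coisotropicProj R c ∈ χ.target ×ˢ (univ : Set (F →L[ℝ] ℝ)) := by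
    intro c hc'
    refine ⟨?_, mem_univ _⟩
    rw [coisotropicProj_apply]
    change R c.1 ∈ χ.target
    rw [← (hc _ hc').2]
    exact χ.map_source (hc _ hc').1
  have hfΛ : ∀ c : E × (F →L[ℝ] ℝ), c.1 ∈ φ.target →
      ContDiffAt ℝ ∞ (f ∘ cotangentLift φ) (coisotropicIncl R c) := by
    intro c hc'
    rw [← contMDiffAt_iff_contDiffAt]
    exact (hf _).comp _ (hΛ.contMDiffAt (hmemΛ c hc'))
  have hhΘ : ∀ c : E × (F →L[ℝ] ℝ), c.1 ∈ φ.target →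
      ContDiffAt ℝ ∞ (h ∘ cotangentLift χ) (coisotropicProj R c) := by
    intro c hc'
    rw [← contMDiffAt_iff_contDiffAt]
    exact (hh _).comp _ (hΘ.contMDiffAt (hmemΘ c hc'))
  have hopen : IsOpen {c : E × (F →L[ℝ] ℝ) | c.1 ∈ φ.target} :=
    φ.open_target.preimage continuous_fst
  have hrel : ∀ c : E × (F →L[ℝ] ℝ), c.1 ∈ φ.target →
      ∀ᶠ c' in 𝓝 c, (f ∘ cotangentLift φ) (coisotropicIncl R c') =
        (h ∘ cotangentLift χ) (coisotropicProj R c') := by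
    intro c hc'
    filter_upwards [hopen.mem_nhds hc'] with d hd
    obtain ⟨ν', h1, h2⟩ := cotangentLift_eq_pullback hπd hφ hχ hc hd d.2
    change f (cotangentLift φ (d.1, d.2.comp R)) = h (cotangentLift χ (R d.1, d.2))
    rw [h1, h2, hfh]
  have hc₀ : (φ m, p₀).1 ∈ φ.target := φ.map_source hm
  have hV : ContDiffAt ℝ 1 (coisotropicVec (f ∘ cotangentLift φ) R L) (φ m, p₀) :=
    (contDiffAt_coisotropicVec (hfΛ (φ m, p₀) hc₀)).of_le (by norm_cast)
  obtain ⟨α, hα₀, ε, hε, hα⟩ :=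
    hV.exists_forall_mem_closedBall_exists_eq_forall_mem_Ioo_hasDerivAt₀ t₀
  have hmem : Ioo (t₀ - ε) (t₀ + ε) ∈ 𝓝 t₀ := Ioo_mem_nhds (by linarith) (by linarith)
  have hαc : ContinuousAt α t₀ := (hα t₀ (mem_of_mem_nhds hmem)).continuousAt
  have hαt : ∀ᶠ t in 𝓝 t₀, (α t).1 ∈ φ.target := by
    refine hαc.preimage_mem_nhds (hopen.mem_nhds ?_)
    rw [hα₀]
    exact hc₀
  refine ⟨fun t => cotangentLift φ (coisotropicIncl R (α t)),
    fun t => cotangentLift χ (coisotropicProj R (α t)), ?_, ?_, ?_, ?_, ?_⟩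
  · obtain ⟨ν', h1, h2⟩ := cotangentLift_eq_pullback hπd hφ hχ hc (φ.map_source hm) p₀
    rw [← hRm, hp₀] at h2
    -- The lift starts over `φ.symm (φ m)`, equal to `m` but not definitionally; generalizing the
    -- point lets the covectors be identified.
    have key : ∀ (m' : M) (ν' : TangentSpace 𝓘(ℝ, F) (π m') →L[ℝ] ℝ), m' = m →
        (⟨π m, ν⟩ : CotangentBundle F N) = ⟨π m', ν'⟩ →
        pullbackCovector π m' ν' = pullbackCovector (E := E) π m ν := by
      rintro _ ν' rfl h
      exact congrArg (pullbackCovector π _) (eq_of_heq (Bundle.TotalSpace.ext_iff.1 h).2).symm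
    simp only [hα₀]
    exact h1.trans (key _ ν' (φ.left_inv hm) h2)
  · simp only [hα₀, coisotropicProj_apply, ← hRm, hp₀]
  · filter_upwards [hmem, hαt] with t ht ht'
    have h1 := (coisotropicIncl R).hasFDerivAt.comp_hasDerivAt t (hα t ht)
    rw [coisotropicIncl_coisotropicVec hRL ((hfΛ _ ht').differentiableAt (by simp))
      ((hhΘ _ ht').differentiableAt (by simp)) (hrel _ ht')] at h1
    exact hΛ.hasMFDerivAt_comp (hmemΛ _ ht') (hf.mdifferentiable (by simp) _) h1
  · filter_upwards [hmem, hαt] with t ht ht'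
    have h1 := (coisotropicProj R).hasFDerivAt.comp_hasDerivAt t (hα t ht)
    rw [coisotropicProj_coisotropicVec hRL ((hfΛ _ ht').differentiableAt (by simp))
      ((hhΘ _ ht').differentiableAt (by simp)) (hrel _ ht')] at h1
    exact hΘ.hasMFDerivAt_comp (hmemΘ _ ht') (hh.mdifferentiable (by simp) _) h1
  · filter_upwards [hαt] with t ht
    obtain ⟨ν', h1, h2⟩ := cotangentLift_eq_pullback hπd hφ hχ hc ht (α t).2
    exact ⟨_, ν', h1, h2⟩

/-- Integral curves of related Hamiltonians that start at related covectors stay related. -/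
theorem isPullback_of_isMIntegralCurveOn [T2Space N]
    (hπ : Manifold.IsSubmersion 𝓘(ℝ, E) 𝓘(ℝ, F) ∞ π)
    (hf : ContMDiff (cotangentModel E) 𝓘(ℝ, ℝ) ∞ f)
    (hh : ContMDiff (cotangentModel F) 𝓘(ℝ, ℝ) ∞ h)
    (hfh : ∀ (m : M) (ν : TangentSpace 𝓘(ℝ, F) (π m) →L[ℝ] ℝ),
      h ⟨π m, ν⟩ = f (pullbackCovector π m ν))
    {a b t₀ : ℝ} (ht₀ : t₀ ∈ Ioo a b)
    {Z : ℝ → CotangentBundle E M} {W : ℝ → CotangentBundle F N}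
    (hZ : IsMIntegralCurveOn (I := cotangentModel E) Z (hamiltonianVectorField f) (Ioo a b))
    (hW : IsMIntegralCurveOn (I := cotangentModel F) W (hamiltonianVectorField h) (Ioo a b))
    (h₀ : IsPullback π (Z t₀) (W t₀)) :
    ∀ t ∈ Ioo a b, IsPullback π (Z t) (W t) := by
  have hZa : ∀ t ∈ Ioo a b, IsMIntegralCurveAt (I := cotangentModel E) Z
    (hamiltonianVectorField f) t := fun t ht => hZ.isMIntegralCurveAt (Ioo_mem_nhds ht.1 ht.2)
  have hWa : ∀ t ∈ Ioo a b, IsMIntegralCurveAt (I := cotangentModel F) W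
    (hamiltonianVectorField h) t := fun t ht => hW.isMIntegralCurveAt (Ioo_mem_nhds ht.1 ht.2)
  -- `U` is open because near a related time uniqueness identifies `Z, W` with the related local
  -- pair; it is closed in the interval by passage to limits. The interval is connected and `t₀ ∈
  -- U`.
  let U : Set ℝ := {t | t ∈ Ioo a b ∧ IsPullback π (Z t) (W t)}
  have hU : IsOpen U := by
    rw [isOpen_iff_mem_nhds]
    rintro t ⟨ht, m, ν, hz, hw⟩
    obtain ⟨Z', W', hZ0, hW0, hZ', hW', hp⟩ := exists_local_integralCurves hπ hf hh hfh m ν t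
    have h1 : Z =ᶠ[𝓝 t] Z' := isMIntegralCurveAt_eventuallyEq_of_contMDiffAt_boundaryless
      ((contMDiff_hamiltonianVectorField hf _).of_le (by norm_cast))
      (hZa t ht) hZ' (hz.trans hZ0.symm)
    have h2 : W =ᶠ[𝓝 t] W' := isMIntegralCurveAt_eventuallyEq_of_contMDiffAt_boundaryless
      ((contMDiff_hamiltonianVectorField hh _).of_le (by norm_cast))
      (hWa t ht) hW' (hw.trans hW0.symm)
    filter_upwards [h1, h2, hp, Ioo_mem_nhds ht.1 ht.2] with s hs1 hs2 hs3 hs4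
    refine ⟨hs4, ?_⟩
    rwa [hs1, hs2]
  have hsub : Ioo a b ⊆ U := by
    refine isPreconnected_Ioo.subset_of_closure_inter_subset hU ⟨t₀, ht₀, ht₀, h₀⟩ ?_
    rintro t ⟨ht, ht'⟩
    refine ⟨ht', isPullback_of_frequently hπ.contMDiff (hZa t ht').continuousAt
      (hWa t ht').continuousAt ?_⟩
    exact (mem_closure_iff_frequently.1 ht).mono fun s hs => hs.2
  exact fun t ht => (hsub ht).2

end LocalCurves

end NestedBundle

end

/-! ### The projection theorem. -/

theorem mainTheorem3
    {E EK EN EH : Type*}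
    [NormedAddCommGroup E] [NormedSpace ℝ E] [FiniteDimensional ℝ E]
    [NormedAddCommGroup EK] [NormedSpace ℝ EK] [FiniteDimensional ℝ EK]
    [NormedAddCommGroup EN] [NormedSpace ℝ EN] [FiniteDimensional ℝ EN]
    [NormedAddCommGroup EH] [NormedSpace ℝ EH] [FiniteDimensional ℝ EH]
    {M NK NH H : Type*}
    -- the manifolds `M`, `NK = M/K` and `NH = M/H`
    [TopologicalSpace M] [T2Space M] [ChartedSpace E M] [IsManifold 𝓘(ℝ, E) ∞ M]
    [TopologicalSpace NK] [T2Space NK] [ChartedSpace EK NK] [IsManifold 𝓘(ℝ, EK) ∞ NK]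
    [TopologicalSpace NH] [T2Space NH] [ChartedSpace EN NH] [IsManifold 𝓘(ℝ, EN) ∞ NH]
    -- the Lie group `H`, its smooth right action on `M`, and the closed subgroup `K`
    [TopologicalSpace H] [ChartedSpace EH H] [Group H] [LieGroup 𝓘(ℝ, EH) ∞ H]
    [MulAction Hᵐᵒᵖ M]
    (hact : ContMDiff (𝓘(ℝ, E).prod 𝓘(ℝ, EH)) 𝓘(ℝ, E) ∞ (fun q : M × H => q.1 <• q.2))
    (K : Subgroup H) (hKc : IsClosed (K : Set H))
    -- the nested principal bundles
    (πH : M → NH) (hπH : NestedBundle.IsPrincipalBundle E EN (⊤ : Subgroup H) πH)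
    (πK : M → NK) (hπK : NestedBundle.IsPrincipalBundle E EK K πK)
    -- the invariant metric of constant bi-invariant type
    (g : NestedBundle.RiemannianMetricOn E M) (hg : NestedBundle.IsInvariant H g)
    (hI : ∀ (m m' : M) (ξ η : GroupLieAlgebra 𝓘(ℝ, EH) H),
      NestedBundle.inertia g m ξ η = NestedBundle.inertia g m' ξ η)
    -- the initial point `m`, and the initial covector `μ` at `n = πK m`
    (m : M) (μ : TangentSpace 𝓘(ℝ, EK) (πK m) →L[ℝ] ℝ) :
    -- the geodesic of `(M, DH, g|DH)` with initial covector `(m, πK* μ)` and the geodesic of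
    -- `(M/K, dπK(DH), g_{M/K})` with initial covector `(n, μ)` exist for small times, and
    (∃ ε > 0, ∃ (γM : ℝ → M) (γK : ℝ → NK),
      NestedBundle.IsSubRiemannianGeodesic (NestedBundle.horizontalDistribution (F := EN) g πH)
        (NestedBundle.metricForm g) (NestedBundle.pullbackCovector πK m μ) (-ε) ε γM ∧
      NestedBundle.IsSubRiemannianGeodesic
        (NestedBundle.pushDistribution πK (NestedBundle.horizontalDistribution (F := EN) g πH))
        (NestedBundle.quotientMetric g πK) ⟨πK m, μ⟩ (-ε) ε γK) ∧
    -- on any common interval of existence they have the same projection to `M/H`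
    ∀ (a b : ℝ), a < 0 → 0 < b → ∀ (γM : ℝ → M) (γK : ℝ → NK),
      NestedBundle.IsSubRiemannianGeodesic (NestedBundle.horizontalDistribution (F := EN) g πH)
        (NestedBundle.metricForm g) (NestedBundle.pullbackCovector πK m μ) a b γM →
      NestedBundle.IsSubRiemannianGeodesic
        (NestedBundle.pushDistribution πK (NestedBundle.horizontalDistribution (F := EN) g πH))
        (NestedBundle.quotientMetric g πK) ⟨πK m, μ⟩ a b γK →
      ∀ t ∈ Ioo a b, πH (γM t) = NestedBundle.nestedProj πK πH hπK.surjective (γK t) := by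
  have hact' : ∀ h : H, ContMDiff 𝓘(ℝ, E) 𝓘(ℝ, E) ∞ (fun x : M => x <• h) := fun h =>
    ContMDiff.comp (g := fun q : M × H => q.1 <• q.2) (f := fun x : M => (x, h)) hact
      (contMDiff_id.prodMk contMDiff_const)
  have hf := NestedBundle.contMDiff_hamiltonian_horizontal g hπH.submersion.contMDiff
    (NestedBundle.mfderiv_surjective_of_isSubmersion hπH.submersion)
  have hfh := NestedBundle.hamiltonian_push_eq le_top hπK hπH hact' hg
  have hh := NestedBundle.contMDiff_of_pullbackCovector hπK.submersion hπK.surjective hf hfh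
  constructor
  · obtain ⟨Z, W, hZ₀, hW₀, hZ, hW, -⟩ :=
      NestedBundle.exists_local_integralCurves hπK.submersion hf hh hfh m μ 0
    obtain ⟨ε₁, hε₁, hZ'⟩ := isMIntegralCurveAt_iff'.1 hZ
    obtain ⟨ε₂, hε₂, hW'⟩ := isMIntegralCurveAt_iff'.1 hW
    have hsub : ∀ r, min ε₁ ε₂ ≤ r → Ioo (-min ε₁ ε₂) (min ε₁ ε₂) ⊆ Metric.ball (0 : ℝ) r := by
      intro r hr
      rw [Real.ball_eq_Ioo]
      exact Ioo_subset_Ioo (by linarith) (by linarith)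
    exact ⟨min ε₁ ε₂, lt_min hε₁ hε₂, _, _,
      ⟨Z, hZ'.mono (hsub _ (min_le_left _ _)), hZ₀, fun _ _ => rfl⟩,
      ⟨W, hW'.mono (hsub _ (min_le_right _ _)), hW₀, fun _ _ => rfl⟩⟩
  · rintro a b ha hb γM γK ⟨Z, hZ, hZ₀, hγM⟩ ⟨W, hW, hW₀, hγK⟩ t ht
    -- Relatedness at time `t` puts the footpoints at `m'` and `πK m'`, so the curve in `M/K` is the
    -- `πK`-image of the curve in `M`.
    obtain ⟨m', ν, hz, hw⟩ := NestedBundle.isPullback_of_isMIntegralCurveOn hπK.submersion hf hh hfh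
      (t₀ := 0) ⟨ha, hb⟩ hZ hW ⟨m, μ, hZ₀, hW₀⟩ t ht
    rw [hγM t ht, hγK t ht, hz, hw]
    exact (NestedBundle.nestedProj_apply le_top hπK hπH m').symm
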